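/- Throughout, $\mathbb N=\{1,2,3,\dots\}$. For a (not necessarily unital) $C^*$-algebra $A$ let $T(A)$ be the set of traces on $A$ (positive linear functionals $\tau$ of norm one with $\tau(ab)=\tau(ba)$ for all $a,b\in A$) with the weak* topology, and, when $T(A)\neq\emptyset$, put $\|a\|_{2,T(A)}=\sup_{\tau\in T(A)}\tau(a^*a)^{1/2}$. Let $\omega$ be a free ultrafilter on $\mathbb N$. The uniform tracial ultrapower of $A$ is $$A^\omega=\ell^\infty(A)\big/\{(a_k)_{k=1}^\infty:\lim_{k\to\omega}\|a_k\|_{2,T(A)}=0\},$$ and $\iota:A\to A^\omega$ is the canonical map given by constant sequences. Let $T_\omega(A)$ be the set of limit traces on $A^\omega$, that is, of the functionals induced by $(a_k)_k\mapsto\lim_{k\to\omega}\tau_k(a_k)$ for sequences $(\tau_k)_{k=1}^\infty$ in $T(A)$. If $A$ is separable and $T(A)$ is non-empty and compact, then $A^\omega$ is unital, and $A$ is said to have *uniform property $\Gamma$* if for every $n\in\mathbb N$ there are projections $p_1,\dots,p_n\in A^\omega$ commuting with $\iota(A)$ and summing to $1_{A^\omega}$ such that $$\tau(\iota(a)p_i)=\tfrac1n\,\tau(\iota(a)),\qquad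 a\in A,\ \tau\in T_\omega(A),\ i=1,\dots,n.$$ **Proposition.** Let $A$ be a separable $C^*$-algebra with $T(A)$ non-empty and compact. Then, for every free ultrafilter $\omega$ on $\mathbb N$, the following are equivalent: (i) $A$ has uniform property $\Gamma$ (formed with $\omega$). (ii) For any finite subset $\mathcal F\subset A$, any $\epsilon>0$ and any $n\in\mathbb N$, there exist pairwise orthogonal positive contractions $e_1,\dots,e_n\in A$ such that, for $i=1,\dots,n$ and $a\in\mathcal F$, $$\|[e_i,a]\|_{2,T(A)}<\epsilon\quad\text{and}\quad\sup_{\tau\in T(A)}\left|\tau(ae_i)-\tfrac1n\tau(a)\right|<\epsilon.$$ (iii) For any finite subset $\mathcal F\subset A$, any $\epsilon>0$ and any $n\in\mathbb N$, there exist pairwise orthogonal positive contractions $e_1,\dots,e_n\in A$ such that, for $i=1,\dots,n$ and $a\in\mathcal F$, $$\|[e_i,a]\|<\epsilon\quad\text{and}\quad\sup_{\tau\in T(A)}\left|\tau(ae_i)-\tfrac1n\tau(a)\right|<\epsilon.$$ -/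

import Mathlib

open Filter Topology
open scoped ENNReal ComplexOrder

namespace UniformGamma

noncomputable section

universe u

/-- The set `T(A)` of traces (tracial states, that is, positive linear functionals of norm one that
vanish on commutators) on a C*-algebra `A`, regarded as a subset of the dual space with the weak*
topology. -/
def traces (A : Type u) [NonUnitalCStarAlgebra A] [PartialOrder A] : Set (WeakDual ℂ A) :=
  {τ | (∀ a : A, 0 ≤ a → 0 ≤ τ a) ∧ ‖WeakDual.toStrongDual τ‖ = 1 ∧
    ∀ a b : A, τ (a * b) = τ (b * a)}

/-- The seminorm `‖a‖_{2,τ} = τ(a* a)^{1/2}`. -/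
def twoNorm {A : Type u} [NonUnitalCStarAlgebra A] (τ : WeakDual ℂ A) (a : A) : ℝ :=
  √(τ (star a * a)).re

/-- The uniform 2-seminorm `‖a‖_{2,X} = sup_{τ ∈ X} ‖a‖_{2,τ}`. -/
def uniformTwoNorm {A : Type u} [NonUnitalCStarAlgebra A] (X : Set (WeakDual ℂ A)) (a : A) : ℝ :=
  ⨆ τ : X, twoNorm τ.1 a

section Basic

set_option linter.unusedSectionVars false

variable {A : Type u} [NonUnitalCStarAlgebra A] [PartialOrder A] [StarOrderedRing A]

/-- A trace as a bundled positive linear map. -/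
def posMap (τ : traces A) : A →ₚ[ℂ] ℂ :=
  PositiveLinearMap.mk₀ (τ.1 : A →L[ℂ] ℂ).toLinearMap τ.2.1

theorem posMap_apply (τ : traces A) (a : A) : posMap τ a = τ.1 a := rfl

theorem twoNorm_eq (τ : traces A) (a : A) :
    twoNorm τ.1 a = ‖(posMap τ).toPreGNS a‖ := rfl

theorem norm_trace_le (τ : traces A) (a : A) : ‖τ.1 a‖ ≤ ‖a‖ := by
  have h := (WeakDual.toStrongDual τ.1).le_opNorm a
  rw [τ.2.2.1, one_mul] at h
  exact h

theorem twoNorm_nonneg (τ : WeakDual ℂ A) (a : A) : 0 ≤ twoNorm τ a := Real.sqrt_nonneg _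

theorem twoNorm_le_norm (τ : traces A) (a : A) : twoNorm τ.1 a ≤ ‖a‖ := by
  refine Real.sqrt_le_iff.2 ⟨norm_nonneg _, ?_⟩
  calc _ ≤ ‖τ.1 (star a * a)‖ := Complex.re_le_norm _
    _ ≤ ‖star a * a‖ := norm_trace_le _ _
    _ = ‖a‖ ^ 2 := by rw [CStarRing.norm_star_mul_self, sq]

theorem twoNorm_zero (τ : traces A) : twoNorm τ.1 (0 : A) = 0 := by
  simp [twoNorm]

theorem twoNorm_neg (τ : WeakDual ℂ A) (a : A) : twoNorm τ (-a) = twoNorm τ a := by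
  simp [twoNorm]

theorem twoNorm_star (τ : traces A) (a : A) : twoNorm τ.1 (star a) = twoNorm τ.1 a := by
  unfold twoNorm
  rw [star_star, τ.2.2.2]

theorem twoNorm_smul (τ : traces A) (c : ℂ) (a : A) :
    twoNorm τ.1 (c • a) = ‖c‖ * twoNorm τ.1 a := by
  rw [twoNorm_eq, twoNorm_eq, map_smul, norm_smul]

theorem twoNorm_add_le (τ : traces A) (a b : A) :
    twoNorm τ.1 (a + b) ≤ twoNorm τ.1 a + twoNorm τ.1 b := by
  simp only [twoNorm_eq, map_add]
  exact norm_add_le _ _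

theorem twoNorm_mul_le (τ : traces A) (a b : A) :
    twoNorm τ.1 (a * b) ≤ ‖a‖ * twoNorm τ.1 b := by
  have h := ((posMap τ).leftMulMapPreGNS a).le_of_opNorm_le
    (LinearMap.mkContinuous_norm_le _ (norm_nonneg a) _) ((posMap τ).toPreGNS b)
  exact h

theorem twoNorm_mul_le' (τ : traces A) (a b : A) :
    twoNorm τ.1 (a * b) ≤ twoNorm τ.1 a * ‖b‖ := by
  rw [← twoNorm_star, star_mul, mul_comm (twoNorm _ _), ← twoNorm_star τ a, ← norm_star b]
  exact twoNorm_mul_le τ _ _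

theorem norm_trace_le_twoNorm (τ : traces A) (a : A) : ‖τ.1 a‖ ≤ twoNorm τ.1 a := by
  have hl := CStarAlgebra.increasingApproximateUnit A
  have := hl.toIsApproximateUnit.neBot
  have h1 : Tendsto (fun e : A => ‖τ.1 (star e * a)‖) (CStarAlgebra.approximateUnit A)
      (𝓝 ‖τ.1 a‖) := by
    have h2 : Tendsto (fun e : A => e * a) (CStarAlgebra.approximateUnit A) (𝓝 a) :=
      hl.toIsApproximateUnit.tendsto_mul_right a
    have h3 : Tendsto (fun e : A => ‖τ.1 (e * a)‖) (CStarAlgebra.approximateUnit A)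
        (𝓝 ‖τ.1 a‖) :=
      ((τ.1.continuous.tendsto a).comp h2).norm
    refine h3.congr' ?_
    filter_upwards [hl.eventually_star_eq] with e he
    rw [he]
  refine le_of_tendsto h1 ?_
  filter_upwards [hl.eventually_norm] with e he
  have h4 : ‖τ.1 (star e * a)‖ ≤ twoNorm τ.1 e * twoNorm τ.1 a :=
    norm_inner_le_norm (𝕜 := ℂ) ((posMap τ).toPreGNS e) ((posMap τ).toPreGNS a)
  refine h4.trans (mul_le_of_le_one_left (twoNorm_nonneg _ _) ?_)
  exact (twoNorm_le_norm τ e).trans he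

theorem bddAbove_twoNorm (a : A) : BddAbove (Set.range fun τ : traces A => twoNorm τ.1 a) :=
  ⟨‖a‖, by rintro _ ⟨τ, rfl⟩; exact twoNorm_le_norm τ a⟩

theorem twoNorm_le_uniformTwoNorm (τ : traces A) (a : A) :
    twoNorm τ.1 a ≤ uniformTwoNorm (traces A) a := le_ciSup (bddAbove_twoNorm a) τ

theorem uniformTwoNorm_nonneg (a : A) : 0 ≤ uniformTwoNorm (traces A) a :=
  Real.iSup_nonneg fun τ => twoNorm_nonneg τ.1 a

theorem uniformTwoNorm_le {a : A} {C : ℝ} (hC : 0 ≤ C) (h : ∀ τ : traces A, twoNorm τ.1 a ≤ C) :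
    uniformTwoNorm (traces A) a ≤ C := Real.iSup_le h hC

theorem uniformTwoNorm_zero : uniformTwoNorm (traces A) (0 : A) = 0 :=
  le_antisymm (uniformTwoNorm_le le_rfl fun τ => (twoNorm_zero τ).le) (uniformTwoNorm_nonneg 0)

theorem uniformTwoNorm_neg (a : A) :
    uniformTwoNorm (traces A) (-a) = uniformTwoNorm (traces A) a := by
  simp only [uniformTwoNorm, twoNorm_neg]

theorem uniformTwoNorm_star (a : A) :
    uniformTwoNorm (traces A) (star a) = uniformTwoNorm (traces A) a := by
  simp only [uniformTwoNorm, twoNorm_star]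

theorem uniformTwoNorm_smul (c : ℂ) (a : A) :
    uniformTwoNorm (traces A) (c • a) = ‖c‖ * uniformTwoNorm (traces A) a := by
  simp only [uniformTwoNorm, twoNorm_smul]
  rw [Real.mul_iSup_of_nonneg (norm_nonneg c)]

theorem uniformTwoNorm_add_le (a b : A) : uniformTwoNorm (traces A) (a + b) ≤
    uniformTwoNorm (traces A) a + uniformTwoNorm (traces A) b :=
  uniformTwoNorm_le (add_nonneg (uniformTwoNorm_nonneg a) (uniformTwoNorm_nonneg b)) fun τ =>
    (twoNorm_add_le τ a b).trans
      (add_le_add (twoNorm_le_uniformTwoNorm τ a) (twoNorm_le_uniformTwoNorm τ b))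

theorem uniformTwoNorm_mul_le (a b : A) :
    uniformTwoNorm (traces A) (a * b) ≤ ‖a‖ * uniformTwoNorm (traces A) b :=
  uniformTwoNorm_le (mul_nonneg (norm_nonneg a) (uniformTwoNorm_nonneg b)) fun τ =>
    (twoNorm_mul_le τ a b).trans
      (mul_le_mul_of_nonneg_left (twoNorm_le_uniformTwoNorm τ b) (norm_nonneg a))

theorem uniformTwoNorm_mul_le' (a b : A) :
    uniformTwoNorm (traces A) (a * b) ≤ uniformTwoNorm (traces A) a * ‖b‖ :=
  uniformTwoNorm_le (mul_nonneg (uniformTwoNorm_nonneg a) (norm_nonneg b)) fun τ =>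
    (twoNorm_mul_le' τ a b).trans
      (mul_le_mul_of_nonneg_right (twoNorm_le_uniformTwoNorm τ a) (norm_nonneg b))

end Basic

/-- `ℓ^∞(A)`, the C*-algebra of bounded sequences in `A`. -/
abbrev BoundedSeq (A : Type u) [NonUnitalCStarAlgebra A] : Type u := lp (fun _ : ℕ => A) ∞

section Ultrapower

variable (A : Type u) [NonUnitalCStarAlgebra A] [PartialOrder A] [StarOrderedRing A]
variable (ω : Ultrafilter ℕ)

/-- The ideal of bounded sequences `(a_n)` with `lim_{n → ω} ‖a_n‖_{2,T(A)} = 0`. -/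
def traceNullIdeal : TwoSidedIdeal (BoundedSeq A) :=
  TwoSidedIdeal.mk'
    {x | Tendsto (fun n => uniformTwoNorm (traces A) (x n)) ω (𝓝 0)}
    (by simp [uniformTwoNorm_zero])
    (by
      intro x y hx hy
      refine squeeze_zero (fun n => uniformTwoNorm_nonneg _)
        (fun n => uniformTwoNorm_add_le (x n) (y n)) ?_
      simpa using hx.add hy)
    (by
      intro x hx
      refine hx.congr fun n => ?_
      exact (uniformTwoNorm_neg (x n)).symm)
    (by
      intro x y hy
      refine squeeze_zero (fun n => uniformTwoNorm_nonneg _)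
        (fun n => (uniformTwoNorm_mul_le (x n) (y n)).trans
          (mul_le_mul_of_nonneg_right (lp.norm_apply_le_norm ENNReal.top_ne_zero x n)
            (uniformTwoNorm_nonneg _))) ?_
      simpa using hy.const_mul ‖x‖)
    (by
      intro x y hx
      refine squeeze_zero (fun n => uniformTwoNorm_nonneg _)
        (fun n => (uniformTwoNorm_mul_le' (x n) (y n)).trans
          (mul_le_mul_of_nonneg_left (lp.norm_apply_le_norm ENNReal.top_ne_zero y n)
            (uniformTwoNorm_nonneg _))) ?_
      simpa using hx.mul_const ‖y‖)

/-- The uniform tracial ultrapower `A^ω`: the quotient of `ℓ^∞(A)` by the ideal of sequences that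
are `‖·‖_{2,T(A)}`-null along `ω`, as a (possibly non-unital) ring. -/
abbrev TracialUltrapower : Type u := (traceNullIdeal A ω).ringCon.Quotient

variable {A}

/-- The class in `A^ω` of a bounded sequence. -/
def mk (x : BoundedSeq A) : TracialUltrapower A ω := (traceNullIdeal A ω).ringCon.toQuotient x

theorem mk_surjective : Function.Surjective (mk ω : BoundedSeq A → _) := Quotient.mk_surjective

variable {ω}

theorem rel_iff {x y : BoundedSeq A} : (traceNullIdeal A ω).ringCon x y ↔
    Tendsto (fun n => uniformTwoNorm (traces A) (x n - y n)) ω (𝓝 0) := by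
  rfl

theorem mk_eq_mk_iff {x y : BoundedSeq A} : mk ω x = mk ω y ↔
    Tendsto (fun n => uniformTwoNorm (traces A) (x n - y n)) ω (𝓝 0) := by
  rw [mk, mk, RingCon.eq, rel_iff]

/-- The involution of `A^ω`, `[(a_n)]* = [(a_n*)]`. -/
instance : Star (TracialUltrapower A ω) where
  star := Quotient.map' star (by
    intro x y h
    refine (rel_iff.1 h).congr fun n => ?_
    rw [← uniformTwoNorm_star, star_sub]
    rfl)

theorem star_mk (x : BoundedSeq A) : star (mk ω x) = mk ω (star x) := rfl

instance : StarRing (TracialUltrapower A ω) where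
  star_involutive x := by
    obtain ⟨x, rfl⟩ := mk_surjective ω x
    rw [star_mk, star_mk, star_star]
  star_mul x y := by
    obtain ⟨x, rfl⟩ := mk_surjective ω x
    obtain ⟨y, rfl⟩ := mk_surjective ω y
    exact congrArg (mk ω) (star_mul x y)
  star_add x y := by
    obtain ⟨x, rfl⟩ := mk_surjective ω x
    obtain ⟨y, rfl⟩ := mk_surjective ω y
    exact congrArg (mk ω) (star_add x y)

/-- Scalar multiplication on `A^ω`, `c [(a_n)] = [(c a_n)]`. -/
instance : SMul ℂ (TracialUltrapower A ω) where
  smul c := Quotient.map' (c • ·) (by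
    intro x y h
    have h' := (rel_iff.1 h).const_mul ‖c‖
    rw [mul_zero] at h'
    refine h'.congr fun n => ?_
    rw [← uniformTwoNorm_smul, smul_sub]
    rfl)

theorem smul_mk (c : ℂ) (x : BoundedSeq A) : c • mk ω x = mk ω (c • x) := rfl

variable (A ω)

/-- The quotient map `ℓ^∞(A) → A^ω` as an additive map. -/
def mkAddHom : BoundedSeq A →+ TracialUltrapower A ω where
  toFun := mk ω
  map_zero' := rfl
  map_add' _ _ := rfl

variable {A ω}

instance : Module ℂ (TracialUltrapower A ω) :=
  Function.Surjective.module ℂ (mkAddHom A ω) (mk_surjective ω) smul_mk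

/-- The constant sequence with value `a`. -/
def constSeq (a : A) : BoundedSeq A :=
  ⟨fun _ => a, memℓp_infty ⟨‖a‖, by rintro _ ⟨_, rfl⟩; exact le_rfl⟩⟩

variable (ω)

/-- The canonical map `ι : A → A^ω` given by constant sequences. -/
def iota (a : A) : TracialUltrapower A ω := mk ω (constSeq a)

variable (A)

/-- The set `T_ω(A)` of limit traces on `A^ω`: the linear functionals of the form
`[(a_n)] ↦ lim_{n → ω} τ_n(a_n)` for a sequence `(τ_n)` of traces on `A`. -/
def limitTraces : Set (TracialUltrapower A ω →ₗ[ℂ] ℂ) :=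
  {φ | ∃ τ : ℕ → traces A, ∀ x : BoundedSeq A,
    Tendsto (fun n => (τ n).1 (x n)) ω (𝓝 (φ (mk ω x)))}

variable {A}

/-- Every sequence of traces on `A` defines a limit trace on `A^ω`. -/
theorem exists_limitTrace (τ : ℕ → traces A) :
    ∃ φ ∈ limitTraces A ω, ∀ x : BoundedSeq A,
      Tendsto (fun n => (τ n).1 (x n)) ω (𝓝 (φ (mk ω x))) := by
  have hex : ∀ x : BoundedSeq A, ∃ z : ℂ, Tendsto (fun n => (τ n).1 (x n)) ω (𝓝 z) := by
    intro x
    have hK : IsCompact (Metric.closedBall (0 : ℂ) ‖x‖) := isCompact_closedBall 0 ‖x‖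
    have hmem : ∀ n, (τ n).1 (x n) ∈ Metric.closedBall (0 : ℂ) ‖x‖ := fun n => by
      rw [mem_closedBall_zero_iff]
      exact (norm_trace_le _ _).trans (lp.norm_apply_le_norm ENNReal.top_ne_zero x n)
    obtain ⟨z, -, hz⟩ := hK.ultrafilter_le_nhds (ω.map fun n => (τ n).1 (x n))
      (by
        rw [le_principal_iff]
        exact Filter.mem_map.2 (Filter.univ_mem' hmem))
    exact ⟨z, hz⟩
  choose L hL using hex
  have hrel : ∀ x y : BoundedSeq A, (traceNullIdeal A ω).ringCon x y → L x = L y := by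
    intro x y h
    have h1 : Tendsto (fun n => (τ n).1 (x n) - (τ n).1 (y n)) ω (𝓝 0) := by
      refine squeeze_zero_norm (fun n => ?_) (rel_iff.1 h)
      rw [← map_sub]
      exact (norm_trace_le_twoNorm _ _).trans (twoNorm_le_uniformTwoNorm _ _)
    exact sub_eq_zero.1 (tendsto_nhds_unique ((hL x).sub (hL y)) h1)
  let φ : TracialUltrapower A ω →ₗ[ℂ] ℂ :=
    { toFun := fun q => Quotient.liftOn' q L hrel
      map_add' := by
        intro p q
        obtain ⟨x, rfl⟩ := mk_surjective ω p
        obtain ⟨y, rfl⟩ := mk_surjective ω q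
        refine tendsto_nhds_unique (hL (x + y)) (((hL x).add (hL y)).congr fun n => ?_)
        rw [← map_add]
        rfl
      map_smul' := by
        intro c p
        obtain ⟨x, rfl⟩ := mk_surjective ω p
        refine tendsto_nhds_unique (hL (c • x)) (((hL x).const_mul c).congr fun n => ?_)
        rw [← smul_eq_mul, ← map_smul]
        rfl }
  exact ⟨φ, ⟨τ, hL⟩, hL⟩

end Ultrapower

/-- Uniform property Γ of `A`, formed with the free ultrafilter `ω` (for `A` separable with `T(A)`
non-empty and compact): for all `n ≥ 1` there are projections `p_1, …, p_n ∈ A^ω ∩ A'` whose sum is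
the multiplicative identity of `A^ω`, with `τ(a p_i) = τ(a)/n` for all `a ∈ A`, all limit traces `τ`
and all `i`. -/
def UniformPropertyGamma (A : Type u) [NonUnitalCStarAlgebra A] [PartialOrder A]
    [StarOrderedRing A] (ω : Ultrafilter ℕ) : Prop :=
  ∀ n : ℕ, 1 ≤ n → ∃ p : Fin n → TracialUltrapower A ω,
    (∀ i, IsStarProjection (p i) ∧ ∀ a : A, Commute (p i) (iota ω a)) ∧
    (∀ x : TracialUltrapower A ω, (∑ i, p i) * x = x ∧ x * (∑ i, p i) = x) ∧
    ∀ a : A, ∀ φ ∈ limitTraces A ω, ∀ i, φ (iota ω a * p i) = (1 / (n : ℂ)) * φ (iota ω a)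

end

end UniformGamma

/-! Since the uniform 2-norm is at most the norm, (iii) gives (ii) at once. The content is (i) ⇒
(iii) and (ii) ⇒ (i).

(i) ⇒ (iii): projections `p_i` summing to the unit are orthogonal (`mul_eq_zero_of_sum_eq_one`), so
the single self-adjoint element x = 1·p_1 + ... + n·p_n encodes them all. Lift x to y in ℓ^∞(A). The
commutators [y, a] lie in the ideal J of trace-null sequences. If u in J is almost a unit on them
and almost commutes with the a's (`exists_quasicentral_mem`), then z = (1-u)y(1-u) is another lift
of x, with commutators small in norm (`exists_lift_almost_commuting`). Tent functions around 1, ...,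
n have disjoint interiors of support, so applied to z they give exactly orthogonal positive
contractions. By polynomial approximation these almost commute with the a's and almost represent the
`p_i`; a suitable coordinate k then has the required traces
(`UniformPropertyGamma.exists_orthogonal`).

(ii) ⇒ (i): a diagonal sequence along a dense sequence of A gives classes `p_i` that are orthogonal,
self-adjoint, central and trace-dividing. It remains to see that they sum to the unit. Compactness
of T(A) gives a positive contraction u with τ(u) close to 1 for all traces at once
(`exists_forall_lt_re_trace`); dividing the trace evenly at u forces the sum of the `e_i` to act
almost as a unit in 2-norm (`uniformTwoNorm_sub_sum_mul_le`). Idempotence follows by multiplying the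
unit by `p_i`. -/

/-! ### Quasicentral approximate units in a closed self-adjoint ideal. -/

section Quasicentral

variable {B : Type*} [NonUnitalCStarAlgebra B]

/-- Almost orthogonal elements have a sum of norm of the order of the square root of their
number. -/
theorem norm_sum_range_sq_le (y : ℕ → B) {C η : ℝ} (hC : ∀ k, ‖y k‖ ≤ C)
    (hy : ∀ k l, k < l → ‖y k * star (y l)‖ ≤ η) (m : ℕ) :
    ‖∑ k ∈ Finset.range m, y k‖ ^ 2 ≤ m * C ^ 2 + m ^ 2 * η := by
  have hη : 0 ≤ η := (norm_nonneg _).trans (hy 0 1 one_pos)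
  have hC0 : 0 ≤ C := (norm_nonneg _).trans (hC 0)
  have h1 : ∀ k l, ‖y k * star (y l)‖ ≤ (if k = l then C ^ 2 else 0) + η := by
    intro k l
    rcases lt_trichotomy k l with h | rfl | h
    · simpa [h.ne] using hy k l h
    · rw [if_pos rfl, CStarRing.norm_self_mul_star, ← sq]
      have := pow_le_pow_left₀ (norm_nonneg _) (hC k) 2
      linarith
    · have h2 := hy l k h
      rw [← norm_star, star_mul, star_star] at h2
      simpa [h.ne'] using h2
  calc ‖∑ k ∈ Finset.range m, y k‖ ^ 2
      = ‖∑ k ∈ Finset.range m, ∑ l ∈ Finset.range m, y k * star (y l)‖ := by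
        rw [sq, ← CStarRing.norm_self_mul_star, star_sum, Finset.sum_mul_sum]
    _ ≤ ∑ k ∈ Finset.range m, ∑ l ∈ Finset.range m, ((if k = l then C ^ 2 else 0) + η) :=
        norm_sum_le_of_le _ fun k _ => norm_sum_le_of_le _ fun l _ => h1 k l
    _ ≤ m * C ^ 2 + m ^ 2 * η := by
        simp only [Finset.sum_add_distrib, Finset.sum_ite_eq, Finset.sum_const, Finset.card_range,
          nsmul_eq_mul]
        rw [Finset.sum_congr rfl fun x hx => if_pos hx]
        simp only [Finset.sum_const, Finset.card_range, nsmul_eq_mul]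
        linarith

/-- A closed self-adjoint ideal contains self-adjoint contractions that almost act as a unit on
finitely many of its elements. -/
theorem exists_approximateUnit_mem (J : NonUnitalStarSubalgebra ℂ B) (hJ : IsClosed (J : Set B))
    (G : Finset B) (hG : ∀ x ∈ G, x ∈ J) {ε : ℝ} (hε : 0 < ε) :
    ∃ u ∈ J, IsSelfAdjoint u ∧ ‖u‖ ≤ 1 ∧ ∀ x ∈ G, ‖x - u * x‖ < ε := by
  have : IsClosed (J : Set B) := hJ
  let _ : PartialOrder J := CStarAlgebra.spectralOrder J
  have _ : StarOrderedRing J := CStarAlgebra.spectralOrderedRing J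
  have hl := CStarAlgebra.increasingApproximateUnit J
  have := hl.toIsApproximateUnit.neBot
  have h1 : ∀ x ∈ G, ∀ᶠ u : J in CStarAlgebra.approximateUnit J, ‖x - (u : B) * x‖ < ε := by
    intro x hx
    have h2 := hl.toIsApproximateUnit.tendsto_mul_right ⟨x, hG x hx⟩
    have h3 := (tendsto_iff_norm_sub_tendsto_zero.1 h2).eventually (gt_mem_nhds hε)
    filter_upwards [h3] with u hu
    rw [norm_sub_rev] at hu
    exact hu
  obtain ⟨u, hu1, hu2, hu3⟩ := (((Finset.eventually_all G).2 h1).and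
    (hl.eventually_norm.and hl.eventually_isSelfAdjoint)).exists
  exact ⟨u, u.2, congrArg Subtype.val hu3, hu2, hu1⟩

/-- A closed self-adjoint ideal contains self-adjoint contractions that almost act as a unit on
finitely many of its elements and almost commute with finitely many elements of the algebra. -/
theorem exists_quasicentral_mem (J : NonUnitalStarSubalgebra ℂ B) (hJ : IsClosed (J : Set B))
    (hmul : ∀ x ∈ J, ∀ a : B, x * a ∈ J)
    (F G : Finset B) (hG : ∀ x ∈ G, x ∈ J) {ε : ℝ} (hε : 0 < ε) :
    ∃ u ∈ J, IsSelfAdjoint u ∧ ‖u‖ ≤ 1 ∧ (∀ a ∈ F, ‖u * a - a * u‖ < ε) ∧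
      ∀ x ∈ G, ‖x - u * x‖ < ε := by
  classical
  -- Formally ua(1-u). If the terms for successive approximate units u are almost orthogonal, their
  -- sum over m of them has norm of order √m, so averaging makes it small.
  let y : B → B → B := fun u a => u * a - u * a * u
  obtain ⟨M, hM0, hM⟩ : ∃ M : ℝ, 0 < M ∧ ∀ a ∈ F, ‖a‖ ≤ M :=
    ⟨∑ a ∈ F, ‖a‖ + 1, by positivity, fun a ha =>
      (Finset.single_le_sum (f := fun a => ‖a‖) (fun _ _ => norm_nonneg _) ha).trans (by simp)⟩
  -- The choices of m and `δ` make each of the two terms m(2M)² and m²δM at most half of (mε/2)²,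
  -- the first one strictly less.
  obtain ⟨m, hm⟩ := exists_nat_gt (2 * (2 * M) ^ 2 / (ε / 2) ^ 2)
  have hm0 : 0 < (m : ℝ) := lt_of_le_of_lt (by positivity) hm
  set δ : ℝ := (ε / 2) ^ 2 / (2 * M) with hδ
  have hδ0 : 0 < δ := by positivity
  -- Closed under the star, since a commutator with a is expressed below through the terms for both
  -- a and a*.
  let F' : Finset B := F ∪ F.image star
  have hM' : ∀ a ∈ F', ‖a‖ ≤ M := by
    intro a ha
    rcases Finset.mem_union.1 ha with h | h
    · exact hM a h
    · obtain ⟨b, hb, rfl⟩ := Finset.mem_image.1 h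
      rw [norm_star]
      exact hM b hb
  obtain ⟨u, hu, huu⟩ := exists_seq_of_forall_finset_exists
    (fun u : B => u ∈ J ∧ IsSelfAdjoint u ∧ ‖u‖ ≤ 1 ∧ ∀ x ∈ G, ‖x - u * x‖ < ε)
    (fun u v => ∀ a ∈ F', ‖y u a - y u a * v‖ < δ) (by
      intro s hs
      obtain ⟨u, huJ, husa, hu1, hu2⟩ := exists_approximateUnit_mem J hJ
        (G ∪ (s ×ˢ F').image fun p => star (y p.1 p.2)) (by
          intro x hx
          rcases Finset.mem_union.1 hx with h | h
          · exact hG x h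
          · obtain ⟨⟨v, a⟩, hp, rfl⟩ := Finset.mem_image.1 h
            have hv := (hs v (Finset.mem_product.1 hp).1).1
            exact star_mem (sub_mem (hmul _ hv _) (hmul _ (hmul _ hv _) _)))
        (lt_min hε hδ0)
      refine ⟨u, ⟨huJ, husa, hu1, fun x hx =>
        (hu2 x (Finset.mem_union_left _ hx)).trans_le (min_le_left _ _)⟩, fun v hv a ha => ?_⟩
      have h := (hu2 _ (Finset.mem_union_right _
        (Finset.mem_image_of_mem (fun p : B × B => star (y p.1 p.2))
          (Finset.mk_mem_product hv ha)))).trans_le (min_le_right _ _)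
      rw [← norm_star, star_sub, star_mul, star_star, husa.star_eq] at h
      exact h)
  have hsum : ∀ a ∈ F', ‖∑ k ∈ Finset.range m, y (u k) a‖ < m * (ε / 2) := by
    intro a ha
    have h1 : ∀ k, ‖y (u k) a‖ ≤ 2 * M := by
      intro k
      have h2 : ‖u k * a‖ ≤ M := (norm_mul_le _ _).trans
        ((mul_le_of_le_one_left (norm_nonneg _) (hu k).2.2.1).trans (hM' a ha))
      calc ‖y (u k) a‖ ≤ ‖u k * a‖ + ‖u k * a * u k‖ := norm_sub_le _ _
        _ ≤ M + M := add_le_add h2 ((norm_mul_le _ _).trans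
          ((mul_le_of_le_one_right (norm_nonneg _) (hu k).2.2.1).trans h2))
        _ = 2 * M := by ring
    have h3 : ∀ k l, k < l → ‖y (u k) a * star (y (u l) a)‖ ≤ δ * M := by
      intro k l hkl
      have h4 : y (u k) a * star (y (u l) a) =
          (y (u k) a - y (u k) a * u l) * (star a * u l) := by
        have : star (y (u l) a) = star a * u l - u l * (star a * u l) := by
          simp only [y, star_sub, star_mul, (hu l).2.1.star_eq]
        rw [this]
        noncomm_ring
      rw [h4]
      refine (norm_mul_le _ _).trans (mul_le_mul (huu k l hkl a ha).le ?_ (norm_nonneg _) hδ0.le)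
      refine (norm_mul_le _ _).trans
        ((mul_le_of_le_one_right (norm_nonneg _) (hu l).2.2.1).trans ?_)
      rw [norm_star]
      exact hM' a ha
    refine lt_of_pow_lt_pow_left₀ 2 (by positivity)
      ((norm_sum_range_sq_le _ h1 h3 m).trans_lt ?_)
    have h5 : δ * M = (ε / 2) ^ 2 / 2 := by rw [hδ]; field_simp
    rw [div_lt_iff₀ (by positivity)] at hm
    rw [h5]
    nlinarith
  have hnorm : ∀ v : B, ‖((m : ℝ)⁻¹) • v‖ = (m : ℝ)⁻¹ * ‖v‖ := fun v => by
    rw [norm_smul, norm_inv, Real.norm_of_nonneg hm0.le]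
  refine ⟨((m : ℝ)⁻¹) • ∑ k ∈ Finset.range m, u k, ?_, ?_, ?_, ?_, ?_⟩
  · have : ((m : ℝ)⁻¹) • ∑ k ∈ Finset.range m, u k =
        (((m : ℝ)⁻¹ : ℝ) : ℂ) • ∑ k ∈ Finset.range m, u k := (Complex.coe_smul _ _).symm
    rw [this]
    exact SMulMemClass.smul_mem _ (sum_mem fun k _ => (hu k).1)
  · exact IsSelfAdjoint.smul (by simp [isSelfAdjoint_iff])
      (isSelfAdjoint_sum _ fun k _ => (hu k).2.1)
  · rw [hnorm, inv_mul_le_iff₀ hm0, mul_one]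
    exact (norm_sum_le_of_le _ fun k _ => (hu k).2.2.1).trans (by simp)
  · intro a ha
    -- Uses [u, a] = ua(1-u) - (ua*(1-u))* for self-adjoint u.
    have h1 : (((m : ℝ)⁻¹) • ∑ k ∈ Finset.range m, u k) * a -
        a * (((m : ℝ)⁻¹) • ∑ k ∈ Finset.range m, u k) = ((m : ℝ)⁻¹) •
        (∑ k ∈ Finset.range m, y (u k) a - star (∑ k ∈ Finset.range m, y (u k) (star a))) := by
      rw [smul_mul_assoc, mul_smul_comm, ← smul_sub, Finset.sum_mul, Finset.mul_sum, star_sum,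
        ← Finset.sum_sub_distrib, ← Finset.sum_sub_distrib]
      congr 1
      refine Finset.sum_congr rfl fun k _ => ?_
      simp only [y, star_sub, star_mul, (hu k).2.1.star_eq, star_star]
      noncomm_ring
    rw [h1, hnorm, inv_mul_lt_iff₀ hm0]
    refine (norm_sub_le _ _).trans_lt ?_
    rw [norm_star]
    have h2 := hsum a (Finset.mem_union_left _ ha)
    have h3 := hsum (star a) (Finset.mem_union_right _ (Finset.mem_image_of_mem _ ha))
    linarith
  · intro x hx
    have h1 : x - (((m : ℝ)⁻¹) • ∑ k ∈ Finset.range m, u k) * x =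
        ((m : ℝ)⁻¹) • ∑ k ∈ Finset.range m, (x - u k * x) := by
      rw [Finset.sum_sub_distrib, smul_sub, Finset.sum_const, Finset.card_range,
        ← Nat.cast_smul_eq_nsmul ℝ, inv_smul_smul₀ hm0.ne', smul_mul_assoc, Finset.sum_mul]
    rw [h1, hnorm, inv_mul_lt_iff₀ hm0]
    have hne : (Finset.range m).Nonempty := by
      simpa [Finset.nonempty_range_iff, Nat.pos_iff_ne_zero] using hm0
    refine (norm_sum_le _ _).trans_lt ?_
    refine (Finset.sum_lt_sum_of_nonempty hne fun k _ => (hu k).2.2.2 x hx).trans_le ?_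
    simp

end Quasicentral

/-! ### Polynomials without constant term and their commutators. -/

section Polynomial

open Polynomial

variable {B : Type*} [NonUnitalCStarAlgebra B]

/-- The functional calculus `P(z)` for the polynomial `P = X q` without constant term. -/
noncomputable def polyCfc (q : ℝ[X]) (z : B) : B := cfcₙ (fun x : ℝ => x * q.eval x) z

theorem polyCfc_mul_X (z : B) (hz : IsSelfAdjoint z) (q : ℝ[X]) :
    polyCfc (q * X) z = z * polyCfc q z := by
  have h : (fun x : ℝ => x * (q * X).eval x) = fun x : ℝ => (fun x => x) x * (x * q.eval x) := by
    ext x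
    simp only [eval_mul, eval_X]
    ring
  rw [polyCfc, h, cfcₙ_mul (fun x : ℝ => x) (fun x : ℝ => x * q.eval x) z (by fun_prop) rfl
    (by fun_prop)
    (by simp), cfcₙ_id' ℝ z]
  rfl

theorem polyCfc_C (z : B) (hz : IsSelfAdjoint z) (c : ℝ) :
    polyCfc (C c) z = (c : ℂ) • z := by
  simp only [polyCfc, eval_C, mul_comm _ c]
  rw [Complex.coe_smul]
  exact cfcₙ_const_mul_id c z

theorem polyCfc_add (z : B) (p q : ℝ[X]) :
    polyCfc (p + q) z = polyCfc p z + polyCfc q z := by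
  simp only [polyCfc, eval_add, mul_add]
  exact cfcₙ_add _ _ z (by fun_prop) (by simp) (by fun_prop) (by simp)

/-- For a polynomial `P` without constant term, `‖[P(z), a]‖` is controlled by `‖[z, a]‖`,
uniformly over self-adjoint `z` of bounded norm. -/
theorem exists_commutator_polyCfc_le (q : ℝ[X]) (R : ℝ) : ∃ K : ℝ, 0 ≤ K ∧
    ∀ z : B, IsSelfAdjoint z → ‖z‖ ≤ R → ‖polyCfc q z‖ ≤ K ∧ ∀ a : B,
      ‖polyCfc q z * a - a * polyCfc q z‖ ≤
        K * ‖z * a - a * z‖ := by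
  rcases lt_or_ge R 0 with hR | hR
  · exact ⟨0, le_rfl, fun z _ hz => absurd (norm_nonneg z) (not_le.2 (hz.trans_lt hR))⟩
  -- The calculus involves X q, so constant q means a linear polynomial; raising the degree is
  -- multiplication by z and the Leibniz rule.
  induction q using Polynomial.induction_on with
  | C c =>
    refine ⟨|c| * R + |c|, by positivity, fun z hz hzR => ?_⟩
    rw [polyCfc_C z hz]
    refine ⟨?_, fun a => ?_⟩
    · rw [norm_smul, Complex.norm_real, Real.norm_eq_abs]
      have := mul_le_mul_of_nonneg_left hzR (abs_nonneg c)
      have := abs_nonneg c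
      linarith
    · rw [smul_mul_assoc, mul_smul_comm, ← smul_sub, norm_smul, Complex.norm_real, Real.norm_eq_abs]
      exact mul_le_mul_of_nonneg_right (le_add_of_nonneg_left (by positivity)) (norm_nonneg _)
  | add p q hp hq =>
    obtain ⟨K, hK0, hK⟩ := hp
    obtain ⟨L, hL0, hL⟩ := hq
    refine ⟨K + L, by positivity, fun z hz hzR => ?_⟩
    rw [polyCfc_add]
    refine ⟨(norm_add_le _ _).trans (add_le_add (hK z hz hzR).1 (hL z hz hzR).1), fun a => ?_⟩
    rw [add_mul, mul_add, add_sub_add_comm, add_mul K]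
    exact (norm_add_le _ _).trans (add_le_add ((hK z hz hzR).2 a) ((hL z hz hzR).2 a))
  | monomial n c hq =>
    obtain ⟨K, hK0, hK⟩ := hq
    refine ⟨R * K + K, by positivity, fun z hz hzR => ?_⟩
    obtain ⟨h1, h2⟩ := hK z hz hzR
    rw [pow_succ, ← mul_assoc, polyCfc_mul_X z hz]
    set w := polyCfc (C c * X ^ n) z
    refine ⟨(norm_mul_le _ _).trans ?_, fun a => ?_⟩
    · exact (mul_le_mul hzR h1 (norm_nonneg _) hR).trans (by linarith)
    · have h3 : z * w * a - a * (z * w) = z * (w * a - a * w) + (z * a - a * z) * w := by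
        noncomm_ring
      have h4 : ‖z * (w * a - a * w)‖ ≤ R * (K * ‖z * a - a * z‖) :=
        (norm_mul_le _ _).trans (mul_le_mul hzR (h2 a) (norm_nonneg _) hR)
      have h5 : ‖(z * a - a * z) * w‖ ≤ ‖z * a - a * z‖ * K :=
        (norm_mul_le _ _).trans (mul_le_mul_of_nonneg_left h1 (norm_nonneg _))
      rw [h3]
      refine (norm_add_le _ _).trans ?_
      linarith

end Polynomial

/-! ### Tent functions and their functional calculus. -/

section Tent

open Polynomial

/-- The tent function of height one centred at `c` and supported on `[c - 1/2, c + 1/2]`. -/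
def tent (c x : ℝ) : ℝ := max 0 (1 - 2 * |x - c|)

theorem continuous_tent (c : ℝ) : Continuous (tent c) := by
  unfold tent
  fun_prop

theorem tent_nonneg (c x : ℝ) : 0 ≤ tent c x := le_max_left _ _

theorem tent_le_one (c x : ℝ) : tent c x ≤ 1 :=
  max_le zero_le_one (by linarith [abs_nonneg (x - c)])

theorem tent_self (c : ℝ) : tent c c = 1 := by simp [tent]

theorem tent_eq_zero {c x : ℝ} (h : 1 / 2 ≤ |x - c|) : tent c x = 0 :=
  max_eq_left (by linarith)

theorem tent_mul_tent {c d : ℝ} (h : 1 ≤ |c - d|) (x : ℝ) : tent c x * tent d x = 0 := by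
  rcases le_or_gt (1 / 2) |x - c| with h1 | h1
  · rw [tent_eq_zero h1, zero_mul]
  · rw [tent_eq_zero (c := d), mul_zero]
    have := abs_sub_le c x d
    rw [abs_sub_comm c x] at this
    linarith

theorem tent_zero {c : ℝ} (hc : 1 ≤ c) : tent c 0 = 0 :=
  tent_eq_zero (by rw [zero_sub, abs_neg]; exact le_trans (by linarith) (le_abs_self c))

/-- Polynomials without constant term approximate tents supported away from zero. -/
theorem exists_polynomial_near_tent {c : ℝ} (hc : 1 ≤ c) {R η : ℝ} (hR : 0 < R) (hη : 0 < η) :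
    ∃ q : ℝ[X], ∀ x ∈ Set.Icc (-R) R, |x * q.eval x - tent c x| ≤ η := by
  -- Dividing by max(x, 1/2) instead of x keeps the quotient continuous and changes nothing where
  -- the tent is nonzero. Approximating the quotient and multiplying by x removes the constant term.
  have hpos : ∀ x : ℝ, 0 < max x (1 / 2) := fun x => lt_max_of_lt_right (by norm_num)
  have hcont : Continuous fun x : ℝ => tent c x / max x (1 / 2) :=
    (continuous_tent c).div (by fun_prop) fun x => (hpos x).ne'
  obtain ⟨q, hq⟩ := exists_polynomial_near_of_continuousOn (-R) R _ hcont.continuousOn (η / R)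
    (div_pos hη hR)
  refine ⟨q, fun x hx => ?_⟩
  have h1 : tent c x = x * (tent c x / max x (1 / 2)) := by
    rcases le_or_gt (1 / 2) x with h | h
    · rw [max_eq_left h, mul_div_cancel₀ _ (by linarith : x ≠ 0)]
    · have : tent c x = 0 := tent_eq_zero (by
        rw [abs_sub_comm]
        exact le_trans (by linarith) (le_abs_self _))
      rw [this]
      simp
  rw [h1, ← mul_sub, abs_mul]
  calc |x| * |q.eval x - tent c x / max x (1 / 2)| ≤ R * (η / R) :=
        mul_le_mul (abs_le.2 hx) (hq x hx).le (abs_nonneg _) hR.le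
    _ = η := by field_simp

variable {B : Type*} [NonUnitalCStarAlgebra B]

/-- The functional calculus of a tent function. -/
noncomputable def tentCfc (c : ℝ) (z : B) : B := cfcₙ (tent c) z

theorem norm_tentCfc_le (c : ℝ) (z : B) : ‖tentCfc c z‖ ≤ 1 :=
  norm_cfcₙ_le fun x _ => by
    rw [Real.norm_of_nonneg (tent_nonneg c x)]
    exact tent_le_one c x

theorem tentCfc_mul_tentCfc {c d : ℝ} (hc : 1 ≤ c) (hd : 1 ≤ d) (hcd : 1 ≤ |c - d|) (z : B) :
    tentCfc c z * tentCfc d z = 0 := by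
  rw [tentCfc, tentCfc, ← cfcₙ_mul (tent c) (tent d) z (continuous_tent c).continuousOn
    (tent_zero hc) (continuous_tent d).continuousOn (tent_zero hd)]
  simp only [tent_mul_tent hcd]
  exact cfcₙ_const_zero ℝ z

/-- Positivity in a form needing no order on `B`: in ℓ^∞(A) the factorisation can be read in each
coordinate. -/
theorem exists_tentCfc_eq_star_mul_self {c : ℝ} (hc : 1 ≤ c) (z : B) :
    ∃ s : B, tentCfc c z = star s * s := by
  have h0 : √(tent c 0) = 0 := by rw [tent_zero hc, Real.sqrt_zero]
  have hcont := (continuous_tent c).sqrt.continuousOn (s := quasispectrum ℝ z)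
  refine ⟨cfcₙ (fun x => √(tent c x)) z, ?_⟩
  rw [(IsSelfAdjoint.cfcₙ (f := fun x => √(tent c x)) (a := z)).star_eq,
    ← cfcₙ_mul _ _ z hcont h0 hcont h0]
  simp only [Real.mul_self_sqrt (tent_nonneg c _)]
  rfl

theorem norm_polyCfc_sub_tentCfc_le {c : ℝ} (hc : 1 ≤ c) {R η : ℝ} {q : ℝ[X]}
    (hq : ∀ x ∈ Set.Icc (-R) R, |x * q.eval x - tent c x| ≤ η) {z : B}
    (hsa : IsSelfAdjoint z) (hz : ‖z‖ ≤ R) :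
    ‖polyCfc q z - tentCfc c z‖ ≤ η := by
  rw [polyCfc, tentCfc, ← cfcₙ_sub _ _ z (by fun_prop) (by simp)
    (continuous_tent c).continuousOn (tent_zero hc)]
  refine norm_cfcₙ_le fun x hx => hq x (abs_le.1 ?_)
  exact (NonUnitalIsometricContinuousFunctionalCalculus.norm_quasispectrum_le z hx hsa).trans hz

end Tent

namespace UniformGamma

noncomputable section

universe u

/-! ### Lifting from the tracial ultrapower. -/

section

variable {A : Type u} [NonUnitalCStarAlgebra A] [PartialOrder A] [StarOrderedRing A]

theorem uniformTwoNorm_le_norm (a : A) : uniformTwoNorm (traces A) a ≤ ‖a‖ :=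
  uniformTwoNorm_le (norm_nonneg a) fun τ => twoNorm_le_norm τ a

theorem norm_trace_le_uniformTwoNorm (τ : traces A) (a : A) :
    ‖τ.1 a‖ ≤ uniformTwoNorm (traces A) a :=
  (norm_trace_le_twoNorm τ a).trans (twoNorm_le_uniformTwoNorm τ a)

theorem twoNorm_sq (τ : traces A) (a : A) : ((twoNorm τ.1 a ^ 2 : ℝ) : ℂ) = τ.1 (star a * a) := by
  have h : 0 ≤ τ.1 (star a * a) := τ.2.1 _ (star_mul_self_nonneg a)
  rw [twoNorm, Real.sq_sqrt (Complex.le_def.1 h).1]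
  exact Complex.ext rfl (Complex.le_def.1 h).2

theorem bddAbove_norm_trace_sub (x a : A) (c : ℂ) :
    BddAbove (Set.range fun τ : traces A => ‖τ.1 x - c * τ.1 a‖) :=
  ⟨‖x‖ + ‖c‖ * ‖a‖, by
    rintro _ ⟨τ, rfl⟩
    refine (norm_sub_le _ _).trans (add_le_add (norm_trace_le τ x) ?_)
    rw [norm_mul]
    exact mul_le_mul_of_nonneg_left (norm_trace_le τ a) (norm_nonneg c)⟩

variable {ω : Ultrafilter ℕ}

theorem mk_mul (x y : BoundedSeq A) : mk ω (x * y) = mk ω x * mk ω y := rfl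

theorem mk_add (x y : BoundedSeq A) : mk ω (x + y) = mk ω x + mk ω y := rfl

theorem mk_sub (x y : BoundedSeq A) : mk ω (x - y) = mk ω x - mk ω y := rfl

theorem mk_zero : mk ω (0 : BoundedSeq A) = 0 := rfl

theorem mk_sum {ι : Type*} (s : Finset ι) (x : ι → BoundedSeq A) :
    mk ω (∑ i ∈ s, x i) = ∑ i ∈ s, mk ω (x i) := map_sum (mkAddHom A ω) x s

theorem mk_eq_zero_iff {x : BoundedSeq A} : mk ω x = 0 ↔
    Tendsto (fun n => uniformTwoNorm (traces A) (x n)) ω (𝓝 0) := by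
  rw [← mk_zero, mk_eq_mk_iff]
  simp

omit [PartialOrder A] [StarOrderedRing A] in
theorem coeFn_sum_apply {ι : Type*} (s : Finset ι) (x : ι → BoundedSeq A) (k : ℕ) :
    (∑ i ∈ s, x i) k = ∑ i ∈ s, x i k := by
  rw [lp.coeFn_sum, Finset.sum_apply]

theorem smul_mul_ultrapower (c : ℂ) (x y : TracialUltrapower A ω) :
    (c • x) * y = c • (x * y) := by
  obtain ⟨x, rfl⟩ := mk_surjective ω x
  obtain ⟨y, rfl⟩ := mk_surjective ω y
  rw [smul_mk, ← mk_mul, ← mk_mul, smul_mk, smul_mul_assoc]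

theorem mul_smul_ultrapower (c : ℂ) (x y : TracialUltrapower A ω) :
    x * (c • y) = c • (x * y) := by
  obtain ⟨x, rfl⟩ := mk_surjective ω x
  obtain ⟨y, rfl⟩ := mk_surjective ω y
  rw [smul_mk, ← mk_mul, ← mk_mul, smul_mk, mul_smul_comm]

theorem star_smul_ultrapower (c : ℂ) (x : TracialUltrapower A ω) :
    star (c • x) = star c • star x := by
  obtain ⟨x, rfl⟩ := mk_surjective ω x
  rw [smul_mk, star_mk, star_mk, smul_mk, star_smul]

variable (A ω) in
/-- The ideal of sequences that are null along `ω`, as a star subalgebra of `ℓ^∞(A)`. -/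
def traceNullSubalgebra : NonUnitalStarSubalgebra ℂ (BoundedSeq A) where
  carrier := {x | mk ω x = 0}
  add_mem' {x y} hx hy := by
    change mk ω x = 0 at hx
    change mk ω y = 0 at hy
    change mk ω (x + y) = 0
    rw [mk_add, hx, hy, add_zero]
  zero_mem' := mk_zero
  mul_mem' {x y} hx _ := by
    change mk ω x = 0 at hx
    change mk ω (x * y) = 0
    rw [mk_mul, hx, zero_mul]
  smul_mem' c x hx := by
    change mk ω x = 0 at hx
    change mk ω (c • x) = 0
    rw [← smul_mk, hx, smul_zero]
  star_mem' {x} hx := by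
    change mk ω x = 0 at hx
    change mk ω (star x) = 0
    rw [← star_mk, hx, star_zero]

theorem mem_traceNullSubalgebra {x : BoundedSeq A} :
    x ∈ traceNullSubalgebra A ω ↔ mk ω x = 0 := Iff.rfl

/-- Holds because the uniform 2-norm is dominated by the norm. Closedness makes the ideal a
C*-algebra, with its own approximate units. -/
theorem isClosed_traceNullSubalgebra :
    IsClosed (traceNullSubalgebra A ω : Set (BoundedSeq A)) := by
  refine isClosed_of_closure_subset fun x hx => ?_
  rw [SetLike.mem_coe, mem_traceNullSubalgebra, mk_eq_zero_iff, Metric.tendsto_nhds]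
  intro ε hε
  obtain ⟨y, hy, hxy⟩ := Metric.mem_closure_iff.1 hx (ε / 2) (half_pos hε)
  rw [SetLike.mem_coe, mem_traceNullSubalgebra, mk_eq_zero_iff] at hy
  filter_upwards [hy.eventually (gt_mem_nhds (half_pos hε))] with n hn
  rw [Real.dist_0_eq_abs, abs_of_nonneg (uniformTwoNorm_nonneg _)]
  calc uniformTwoNorm (traces A) (x n)
      = uniformTwoNorm (traces A) ((x - y) n + y n) := by simp
    _ ≤ ‖(x - y) n‖ + uniformTwoNorm (traces A) (y n) :=
      (uniformTwoNorm_add_le _ _).trans (add_le_add_left (uniformTwoNorm_le_norm _) _)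
    _ < ε / 2 + ε / 2 := add_lt_add
      ((lp.norm_apply_le_norm ENNReal.top_ne_zero _ n).trans_lt (by rwa [← dist_eq_norm])) hn
    _ = ε := add_halves ε

/-- For every trace, ‖x_i‖_{2,τ}² is at most τ of the whole sum, hence at most the uniform 2-norm of
the sum. This replaces a positivity argument in A^ω. -/
theorem eq_zero_of_sum_star_mul_self_eq_zero {ι : Type*} {s : Finset ι}
    {x : ι → TracialUltrapower A ω} (h : ∑ i ∈ s, star (x i) * x i = 0) {i : ι} (hi : i ∈ s) :
    x i = 0 := by
  choose y hy using fun i => mk_surjective ω (x i)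
  obtain rfl : (fun i => mk ω (y i)) = x := funext hy
  simp only [star_mk, ← mk_mul, ← mk_sum] at h
  rw [mk_eq_zero_iff] at h ⊢
  have h2 : Tendsto (fun n => √(uniformTwoNorm (traces A)
      ((∑ i ∈ s, star (y i) * y i : BoundedSeq A) n))) ω (𝓝 0) := by
    simpa using h.sqrt
  refine squeeze_zero (fun n => uniformTwoNorm_nonneg _) (fun n => ?_) h2
  refine uniformTwoNorm_le (Real.sqrt_nonneg _) fun τ => Real.le_sqrt_of_sq_le ?_
  refine le_trans ?_ (norm_trace_le_uniformTwoNorm τ _)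
  have h3 : τ.1 ((∑ i ∈ s, star (y i) * y i : BoundedSeq A) n) =
      ((∑ i ∈ s, twoNorm τ.1 (y i n) ^ 2 : ℝ) : ℂ) := by
    rw [coeFn_sum_apply, map_sum, Complex.ofReal_sum]
    exact Finset.sum_congr rfl fun j _ => (twoNorm_sq τ _).symm
  rw [h3, Complex.norm_real, Real.norm_eq_abs]
  exact (Finset.single_le_sum (f := fun i => twoNorm τ.1 (y i n) ^ 2)
    (fun _ _ => sq_nonneg _) hi).trans (le_abs_self _)

/-- Projections of the tracial ultrapower with sum one are pairwise orthogonal. -/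
theorem mul_eq_zero_of_sum_eq_one {n : ℕ} {p : Fin n → TracialUltrapower A ω}
    (hp : ∀ i, IsStarProjection (p i)) (h1 : ∀ x, (∑ i, p i) * x = x) {i j : Fin n}
    (hij : i ≠ j) : p i * p j = 0 := by
  -- Compressing the unit by `p j` gives p_j = Σ_k p_j p_k p_j; cancelling the term k = j leaves a
  -- vanishing sum of the (p_k p_j)*(p_k p_j).
  have h2 : ∑ k ∈ Finset.univ.erase j, star (p k * p j) * (p k * p j) = 0 := by
    have h3 : ∀ k, star (p k * p j) * (p k * p j) = p j * (p k * p j) := fun k => by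
      rw [star_mul, (hp k).isSelfAdjoint.star_eq, (hp j).isSelfAdjoint.star_eq, mul_assoc,
        ← mul_assoc (p k), (hp k).isIdempotentElem.eq]
    have h4 := Finset.add_sum_erase Finset.univ (fun k => p j * (p k * p j)) (Finset.mem_univ j)
    have h5 : ∑ k, p j * (p k * p j) = p j := by
      rw [← Finset.mul_sum, ← Finset.sum_mul, h1, (hp j).isIdempotentElem.eq]
    rw [h5, (hp j).isIdempotentElem.eq, (hp j).isIdempotentElem.eq, add_eq_left] at h4
    rw [← h4]
    exact Finset.sum_congr rfl fun k _ => h3 k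
  exact eq_zero_of_sum_star_mul_self_eq_zero h2
    (Finset.mem_erase.2 ⟨hij, Finset.mem_univ i⟩)

/-- An identity for all limit traces holds approximately, uniformly over all traces. -/
theorem tendsto_iSup_norm_trace_sub (hne : (traces A).Nonempty) {x y : BoundedSeq A} {c : ℂ}
    (h : ∀ φ ∈ limitTraces A ω, φ (mk ω x) = c * φ (mk ω y)) :
    Tendsto (fun k => ⨆ τ : traces A, ‖τ.1 (x k) - c * τ.1 (y k)‖) ω (𝓝 0) := by
  have : Nonempty (traces A) := hne.to_subtype
  -- Traces attaining the supremum up to a factor 2 suffice; the limit trace they define carries the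
  -- hypothesis.
  have h1 : ∀ k, ∃ τ : traces A, (⨆ τ : traces A, ‖τ.1 (x k) - c * τ.1 (y k)‖) ≤
      2 * ‖τ.1 (x k) - c * τ.1 (y k)‖ := by
    intro k
    set D := ⨆ τ : traces A, ‖τ.1 (x k) - c * τ.1 (y k)‖ with hD
    rcases le_or_gt D 0 with h0 | h0
    · exact ⟨Classical.arbitrary _, h0.trans (by positivity)⟩
    · obtain ⟨τ, hτ⟩ := exists_lt_of_lt_ciSup (hD ▸ half_lt_self h0 : D / 2 < _)
      exact ⟨τ, by linarith⟩
  choose τ hτ using h1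
  obtain ⟨φ, hφ, hlim⟩ := exists_limitTrace ω τ
  have h2 : Tendsto (fun k => 2 * ‖(τ k).1 (x k) - c * (τ k).1 (y k)‖) ω (𝓝 0) := by
    have h3 := ((hlim x).sub ((hlim y).const_mul c)).norm.const_mul 2
    rwa [h φ hφ, sub_self, norm_zero, mul_zero] at h3
  exact squeeze_zero (fun k => Real.iSup_nonneg fun τ => norm_nonneg _) hτ h2

/-- A self-adjoint element of `A^ω` that commutes with given elements has self-adjoint lifts of
controlled norm that commute with them up to a small error in norm. -/
theorem exists_lift_almost_commuting {y : BoundedSeq A} (hy : IsSelfAdjoint y)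
    (F : Finset (BoundedSeq A)) (hF : ∀ a ∈ F, Commute (mk ω y) (mk ω a)) {δ : ℝ} (hδ : 0 < δ) :
    ∃ z : BoundedSeq A, IsSelfAdjoint z ∧ mk ω z = mk ω y ∧ ‖z‖ ≤ 4 * ‖y‖ ∧
      ∀ a ∈ F, ‖z * a - a * z‖ < δ := by
  classical
  obtain ⟨u, huJ, hu, hu1, huF, huG⟩ := exists_quasicentral_mem (traceNullSubalgebra A ω)
    isClosed_traceNullSubalgebra (fun x hx a => by
      rw [mem_traceNullSubalgebra] at hx ⊢
      rw [mk_mul, hx, zero_mul])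
    F (F.image fun a => y * a - a * y) (by
      intro x hx
      obtain ⟨a, ha, rfl⟩ := Finset.mem_image.1 hx
      rw [mem_traceNullSubalgebra, mk_sub, mk_mul, mk_mul, (hF a ha).eq, sub_self])
    (show 0 < δ / (4 * ‖y‖ + 3) by positivity)
  rw [mem_traceNullSubalgebra] at huJ
  have hl : ∀ w : BoundedSeq A, ‖w - u * w‖ ≤ 2 * ‖w‖ := fun w => by
    refine (norm_sub_le _ _).trans ?_
    have := (norm_mul_le u w).trans (mul_le_of_le_one_left (norm_nonneg _) hu1)
    linarith
  have hr : ∀ w : BoundedSeq A, ‖w - w * u‖ ≤ 2 * ‖w‖ := fun w => by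
    refine (norm_sub_le _ _).trans ?_
    have := (norm_mul_le w u).trans (mul_le_of_le_one_right (norm_nonneg _) hu1)
    linarith
  -- This is (1-u)y(1-u). As u is only a self-adjoint contraction, each factor 1-u costs 2, whence
  -- 4‖y‖ in the norm bound and (4‖y‖+2)δ/(4‖y‖+3) in the commutator bound.
  refine ⟨(y - u * y) - (y - u * y) * u, ?_, ?_, ?_, fun a ha => ?_⟩
  · rw [isSelfAdjoint_iff]
    simp only [star_sub, star_mul, hu.star_eq, hy.star_eq]
    noncomm_ring
  · simp only [mk_sub, mk_mul, huJ, zero_mul, mul_zero, sub_zero]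
  · refine (hr _).trans ?_
    linarith [hl y]
  · have h1 : ((y - u * y) - (y - u * y) * u) * a - a * ((y - u * y) - (y - u * y) * u) =
        (((y * a - a * y) - u * (y * a - a * y)) - ((y * a - a * y) - u * (y * a - a * y)) * u) -
        (u * a - a * u) * (y - y * u) - (y - u * y) * (u * a - a * u) := by
      noncomm_ring
    have h2 := huF a ha
    have h3 := huG _ (Finset.mem_image_of_mem _ ha)
    have h4 := hr ((y * a - a * y) - u * (y * a - a * y))
    have h5 : ‖(u * a - a * u) * (y - y * u)‖ ≤ δ / (4 * ‖y‖ + 3) * (2 * ‖y‖) :=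
      (norm_mul_le _ _).trans (mul_le_mul h2.le (hr y) (norm_nonneg _) (by positivity))
    have h6 : ‖(y - u * y) * (u * a - a * u)‖ ≤ (2 * ‖y‖) * (δ / (4 * ‖y‖ + 3)) :=
      (norm_mul_le _ _).trans (mul_le_mul (hl y) h2.le (norm_nonneg _) (by positivity))
    have h7 : δ / (4 * ‖y‖ + 3) * (4 * ‖y‖ + 3) = δ := by field_simp
    have h8 : 0 < δ / (4 * ‖y‖ + 3) := by positivity
    rw [h1]
    refine (norm_sub_le _ _).trans_lt ?_
    have := norm_sub_le (((y * a - a * y) - u * (y * a - a * y)) -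
      ((y * a - a * y) - u * (y * a - a * y)) * u) ((u * a - a * u) * (y - y * u))
    linarith

/-- Polynomials without constant term of a combination of orthogonal projections. -/
theorem mk_polyCfc {n : ℕ} {p : Fin n → TracialUltrapower A ω}
    (hp : ∀ i, p i * p i = p i) (hpp : ∀ i j, i ≠ j → p i * p j = 0) (c : Fin n → ℝ)
    {z : BoundedSeq A} (hz : IsSelfAdjoint z) (hmk : mk ω z = ∑ i, (c i : ℂ) • p i)
    (q : Polynomial ℝ) :
    mk ω (polyCfc q z) = ∑ i, ((c i * q.eval (c i) : ℝ) : ℂ) • p i := by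
  induction q using Polynomial.induction_on with
  | C r =>
    rw [polyCfc_C z hz, ← smul_mk, hmk, Finset.smul_sum]
    refine Finset.sum_congr rfl fun i _ => ?_
    rw [smul_smul, Polynomial.eval_C, mul_comm (c i), Complex.ofReal_mul]
  | add r s hr hs =>
    rw [polyCfc_add, mk_add, hr, hs, ← Finset.sum_add_distrib]
    refine Finset.sum_congr rfl fun i _ => ?_
    rw [← add_smul, Polynomial.eval_add, mul_add, Complex.ofReal_add]
  | monomial m r h =>
    rw [pow_succ, ← mul_assoc, polyCfc_mul_X z hz, mk_mul, h, hmk, Finset.sum_mul]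
    refine Finset.sum_congr rfl fun i _ => ?_
    rw [Finset.mul_sum, Finset.sum_eq_single i]
    · rw [smul_mul_ultrapower, mul_smul_ultrapower, hp, smul_smul, ← Complex.ofReal_mul,
        Polynomial.eval_mul_X]
      congr 2
      ring
    · intro j _ hj
      rw [smul_mul_ultrapower, mul_smul_ultrapower, hpp i j hj.symm, smul_zero, smul_zero]
    · simp

theorem exists_isSelfAdjoint_lift {x : TracialUltrapower A ω} (hx : IsSelfAdjoint x) :
    ∃ y : BoundedSeq A, IsSelfAdjoint y ∧ mk ω y = x := by
  obtain ⟨y, rfl⟩ := mk_surjective ω x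
  refine ⟨(1 / 2 : ℂ) • (y + star y), ?_, ?_⟩
  · exact IsSelfAdjoint.smul (by simp [isSelfAdjoint_iff]) (IsSelfAdjoint.add_star_self y)
  · rw [← smul_mk, mk_add, ← star_mk, hx.star_eq, ← two_smul ℂ, smul_smul]
    simp

end

/-! ### From uniform property Γ to orthogonal almost central elements. -/

section

variable {A : Type u} [NonUnitalCStarAlgebra A] [PartialOrder A] [StarOrderedRing A]
variable {ω : Ultrafilter ℕ}

theorem tent_natCast_add_one {n : ℕ} (i j : Fin n) :
    tent ((i : ℝ) + 1) ((j : ℝ) + 1) = if i = j then 1 else 0 := by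
  split_ifs with h
  · rw [h, tent_self]
  · refine tent_eq_zero ?_
    have h1 : (1 : ℤ) ≤ |(j : ℤ) - (i : ℤ)| := Int.one_le_abs (by
      rw [sub_ne_zero]
      exact fun h2 => h (Fin.ext (by exact_mod_cast h2.symm)))
    have h2 : (1 : ℝ) ≤ |(j : ℝ) - (i : ℝ)| := by exact_mod_cast h1
    rw [add_sub_add_right_eq_sub]
    linarith

theorem one_le_abs_natCast_sub {n : ℕ} {i j : Fin n} (h : i ≠ j) :
    1 ≤ |((i : ℝ) + 1) - ((j : ℝ) + 1)| := by
  have h1 : (1 : ℤ) ≤ |(i : ℤ) - (j : ℤ)| := Int.one_le_abs (by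
    rw [sub_ne_zero]
    exact fun h2 => h (Fin.ext (by exact_mod_cast h2)))
  rw [add_sub_add_right_eq_sub]
  exact_mod_cast h1

omit [PartialOrder A] [StarOrderedRing A] in
theorem norm_constSeq_le (a : A) : ‖constSeq a‖ ≤ ‖a‖ :=
  lp.norm_le_of_forall_le (norm_nonneg a) fun _ => le_rfl

/-- Uniform property Γ gives orthogonal almost central positive contractions in `A` that almost
divide all traces. -/
theorem UniformPropertyGamma.exists_orthogonal (hne : (traces A).Nonempty)
    (h : UniformPropertyGamma A ω) (F : Finset A) {ε : ℝ} (hε : 0 < ε) {n : ℕ} (hn : 1 ≤ n) :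
    ∃ e : Fin n → A, (∀ i, 0 ≤ e i ∧ ‖e i‖ ≤ 1) ∧ (∀ i j, i ≠ j → e i * e j = 0) ∧
      ∀ i, ∀ a ∈ F, ‖e i * a - a * e i‖ < ε ∧
        (⨆ τ : traces A, ‖τ.1 (a * e i) - (1 / (n : ℂ)) * τ.1 a‖) < ε := by
  classical
  have : Nonempty (traces A) := hne.to_subtype
  obtain ⟨p, hp, hsum, htr⟩ := h n hn
  have hidem : ∀ i, p i * p i = p i := fun i => (hp i).1.isIdempotentElem.eq
  have hpp : ∀ i j, i ≠ j → p i * p j = 0 := fun i j hij =>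
    mul_eq_zero_of_sum_eq_one (fun i => (hp i).1) (fun x => (hsum x).1) hij
  let c : Fin n → ℝ := fun i => (i : ℝ) + 1
  have hc : ∀ i, 1 ≤ c i := fun i => le_add_of_nonneg_left (Nat.cast_nonneg _)
  choose b hb using fun i => mk_surjective ω (p i)
  have hxsa : IsSelfAdjoint (∑ i, (c i : ℂ) • p i) := isSelfAdjoint_sum _ fun i _ => by
    rw [isSelfAdjoint_iff, star_smul_ultrapower, (hp i).1.isSelfAdjoint.star_eq]
    simp
  obtain ⟨y, hy, hyx⟩ := exists_isSelfAdjoint_lift hxsa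
  obtain ⟨L, hL0, hL⟩ : ∃ L : ℝ, 0 < L ∧ ∀ a ∈ F, ‖a‖ ≤ L :=
    ⟨∑ a ∈ F, ‖a‖ + 1, by positivity, fun a ha =>
      (Finset.single_le_sum (f := fun a => ‖a‖) (fun _ _ => norm_nonneg _) ha).trans (by simp)⟩
  set M : ℝ := ∑ i, ‖b i‖ + 1 with hM
  have hM1 : 1 ≤ M := le_add_of_nonneg_left (by positivity)
  -- Bounds both ‖z‖ and the nodes `c j` ≤ n, so that the polynomials approximate the tents on the
  -- spectrum of z and at the nodes.
  set R : ℝ := 4 * ‖y‖ + n with hR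
  have hn0 : (0 : ℝ) < n := by exact_mod_cast hn
  have hR0 : 0 < R := by positivity
  have hcR : ∀ j, c j ∈ Set.Icc (-R) R := fun j => by
    have h1 : ((j : ℕ) : ℝ) + 1 ≤ n := by exact_mod_cast j.2
    have h2 := norm_nonneg y
    have h3 := hc j
    exact ⟨by linarith, by simp only [c]; linarith⟩
  obtain ⟨η, hη0, hη⟩ : ∃ η : ℝ, 0 < η ∧ L * (η * (M + 1)) = ε / 4 :=
    ⟨ε / (4 * (L * (M + 1))), by positivity, by field_simp⟩
  have hηL : 2 * (η * L) ≤ ε / 4 := by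
    have : 0 ≤ L * η * (M - 1) := mul_nonneg (by positivity) (by linarith)
    linarith
  choose q hq using fun i => exists_polynomial_near_tent (hc i) hR0 hη0
  choose K hK0 hK using fun i => exists_commutator_polyCfc_le (B := BoundedSeq A) (q i) R
  obtain ⟨δ, hδ0, hδ⟩ : ∃ δ : ℝ, 0 < δ ∧ ∀ i, K i * δ ≤ ε / 4 := by
    have hK1 : 0 ≤ ∑ i, K i := Finset.sum_nonneg fun i _ => hK0 i
    refine ⟨ε / 4 / (∑ i, K i + 1), by positivity, fun i => ?_⟩
    rw [mul_div_assoc', div_le_iff₀ (by positivity), mul_comm]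
    have h1 : K i ≤ ∑ i, K i := Finset.single_le_sum (fun i _ => hK0 i) (Finset.mem_univ i)
    exact mul_le_mul_of_nonneg_left (by linarith) (by positivity)
  obtain ⟨z, hz, hzy, hzR, hzF⟩ := exists_lift_almost_commuting (ω := ω) hy (F.image constSeq) (by
    intro a' ha'
    obtain ⟨a, -, rfl⟩ := Finset.mem_image.1 ha'
    rw [hyx]
    refine Finset.sum_induction _ (fun x => Commute x (iota ω a)) (fun _ _ => Commute.add_left)
      (Commute.zero_left _) fun i _ => ?_
    rw [commute_iff_eq, smul_mul_ultrapower, mul_smul_ultrapower, ((hp i).2 a).eq]) hδ0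
  have hzR' : ‖z‖ ≤ R := hzR.trans (by linarith)
  let v : Fin n → BoundedSeq A := fun i => polyCfc (q i) z
  let e : Fin n → BoundedSeq A := fun i => tentCfc (c i) z
  let r : Fin n → Fin n → ℝ := fun i j => c j * (q i).eval (c j)
  -- The coefficients `r i j` are within η of the Kronecker delta, and `d i` has the same class as
  -- `v i`. Thus e - b splits into e - v and d - b, small in norm, and v - d, null along ω; no norm
  -- on A^ω is needed.
  let d : Fin n → BoundedSeq A := fun i => ∑ j, (r i j : ℂ) • b j
  have hve : ∀ i, ‖v i - e i‖ ≤ η := fun i =>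
    norm_polyCfc_sub_tentCfc_le (hc i) (hq i) hz hzR'
  have hvd : ∀ i, mk ω (v i - d i) = 0 := fun i => by
    rw [mk_sub, sub_eq_zero, mk_polyCfc hidem hpp c hz (hzy.trans hyx) (q i), mk_sum]
    refine Finset.sum_congr rfl fun j _ => ?_
    rw [← smul_mk, hb]
  have hdb : ∀ i, ‖d i - b i‖ ≤ η * M := by
    intro i
    have h1 : d i - b i = ∑ j, ((r i j - tent (c i) (c j) : ℝ) : ℂ) • b j := by
      simp only [Complex.ofReal_sub, sub_smul, Finset.sum_sub_distrib, c, tent_natCast_add_one,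
        d]
      congr 1
      rw [Finset.sum_eq_single i (fun j _ hj => by
        rw [if_neg hj.symm, Complex.ofReal_zero, zero_smul]) (by simp), if_pos rfl,
        Complex.ofReal_one, one_smul]
    rw [h1]
    calc ‖∑ j, ((r i j - tent (c i) (c j) : ℝ) : ℂ) • b j‖ ≤ ∑ j, η * ‖b j‖ := by
          refine norm_sum_le_of_le _ fun j _ => ?_
          rw [norm_smul, Complex.norm_real]
          exact mul_le_mul_of_nonneg_right (hq i _ (hcR j)) (norm_nonneg _)
      _ ≤ η * M := by
          rw [← Finset.mul_sum]
          exact mul_le_mul_of_nonneg_left (by linarith) hη0.le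
  have hev1 : ∀ᶠ k in (ω : Filter ℕ), ∀ i, uniformTwoNorm (traces A) ((v i - d i) k) <
      ε / (4 * L) :=
    eventually_all.2 fun i => (mk_eq_zero_iff.1 (hvd i)).eventually (gt_mem_nhds (by positivity))
  have hev2 : ∀ᶠ k in (ω : Filter ℕ), ∀ i, ∀ a ∈ F,
      (⨆ τ : traces A, ‖τ.1 (a * b i k) - (1 / (n : ℂ)) * τ.1 a‖) < ε / 4 := by
    refine eventually_all.2 fun i => (Finset.eventually_all F).2 fun a _ => ?_
    have h1 := tendsto_iSup_norm_trace_sub (ω := ω) hne (x := constSeq a * b i)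
      (y := constSeq a) (c := 1 / (n : ℂ)) (fun φ hφ => by
        rw [mk_mul, hb]
        exact htr a φ hφ i)
    exact h1.eventually (gt_mem_nhds (by positivity))
  obtain ⟨k, hk1, hk2⟩ := (hev1.and hev2).exists
  have heb : ∀ i, L * uniformTwoNorm (traces A) (e i k - b i k) ≤ ε / 4 + ε / 4 := by
    intro i
    have h1 : e i k - b i k = -(v i - e i) k + (v i - d i) k + (d i - b i) k := by
      change e i k - b i k = -(v i k - e i k) + (v i k - d i k) + (d i k - b i k)
      abel
    have h2 : uniformTwoNorm (traces A) (-(v i - e i) k) ≤ η := by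
      rw [uniformTwoNorm_neg]
      exact (uniformTwoNorm_le_norm _).trans
        ((lp.norm_apply_le_norm ENNReal.top_ne_zero _ k).trans (hve i))
    have h3 : uniformTwoNorm (traces A) ((d i - b i) k) ≤ η * M :=
      (uniformTwoNorm_le_norm _).trans
        ((lp.norm_apply_le_norm ENNReal.top_ne_zero _ k).trans (hdb i))
    have h4 : uniformTwoNorm (traces A) (e i k - b i k) ≤ η + ε / (4 * L) + η * M := by
      rw [h1]
      exact (uniformTwoNorm_add_le _ _).trans (add_le_add ((uniformTwoNorm_add_le _ _).trans
        (add_le_add h2 (hk1 i).le)) h3)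
    calc L * uniformTwoNorm (traces A) (e i k - b i k) ≤ L * (η + ε / (4 * L) + η * M) :=
          mul_le_mul_of_nonneg_left h4 hL0.le
      _ = L * (η * (M + 1)) + L * (ε / (4 * L)) := by ring
      _ = ε / 4 + ε / 4 := by
          rw [hη]
          congr 1
          field_simp
  refine ⟨fun i => e i k, fun i => ⟨?_, ?_⟩, fun i j hij => ?_, fun i a ha => ⟨?_, ?_⟩⟩
  · obtain ⟨s, hs⟩ := exists_tentCfc_eq_star_mul_self (hc i) z
    change 0 ≤ (tentCfc (c i) z : BoundedSeq A) k
    rw [hs]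
    exact star_mul_self_nonneg (s k)
  · exact (lp.norm_apply_le_norm ENNReal.top_ne_zero _ k).trans (norm_tentCfc_le (c i) z)
  · have h1 : e i * e j = 0 :=
      tentCfc_mul_tentCfc (hc i) (hc j) (one_le_abs_natCast_sub hij) z
    exact congrArg (fun x : BoundedSeq A => x k) h1
  · have h1 : e i * constSeq a - constSeq a * e i = (v i * constSeq a - constSeq a * v i) -
        ((v i - e i) * constSeq a - constSeq a * (v i - e i)) := by
      noncomm_ring
    have h2 : ‖v i * constSeq a - constSeq a * v i‖ ≤ ε / 4 :=
      ((hK i z hz hzR').2 (constSeq a)).trans ((mul_le_mul_of_nonneg_left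
        (hzF _ (Finset.mem_image_of_mem _ ha)).le (hK0 i)).trans (hδ i))
    have hcL : ‖constSeq a‖ ≤ L := (norm_constSeq_le a).trans (hL a ha)
    have h3 : ‖(v i - e i) * constSeq a‖ ≤ η * L :=
      (norm_mul_le _ _).trans (mul_le_mul (hve i) hcL (norm_nonneg _) hη0.le)
    have h4 : ‖constSeq a * (v i - e i)‖ ≤ L * η :=
      (norm_mul_le _ _).trans (mul_le_mul hcL (hve i) (norm_nonneg _) hL0.le)
    calc ‖e i k * a - a * e i k‖ = ‖(e i * constSeq a - constSeq a * e i) k‖ := rfl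
      _ ≤ ‖e i * constSeq a - constSeq a * e i‖ :=
          lp.norm_apply_le_norm ENNReal.top_ne_zero _ k
      _ ≤ ε / 4 + (η * L + L * η) := by
          rw [h1]
          exact (norm_sub_le _ _).trans (add_le_add h2 ((norm_sub_le _ _).trans
            (add_le_add h3 h4)))
      _ < ε := by linarith
  · refine lt_of_le_of_lt (ciSup_le fun τ => ?_)
      (show ε / 4 + ε / 4 + (⨆ τ : traces A, ‖τ.1 (a * b i k) - (1 / (n : ℂ)) * τ.1 a‖) < ε by
        linarith [hk2 i a ha])
    have h1 : τ.1 (a * e i k) - (1 / (n : ℂ)) * τ.1 a =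
        τ.1 (a * (e i k - b i k)) + (τ.1 (a * b i k) - (1 / (n : ℂ)) * τ.1 a) := by
      rw [mul_sub, map_sub]
      ring
    rw [h1]
    refine (norm_add_le _ _).trans (add_le_add ?_
      (le_ciSup (bddAbove_norm_trace_sub (a * b i k) a (1 / (n : ℂ))) τ))
    refine (norm_trace_le_uniformTwoNorm τ _).trans ((uniformTwoNorm_mul_le _ _).trans ?_)
    exact (mul_le_mul_of_nonneg_right (hL a ha) (uniformTwoNorm_nonneg _)).trans (heb i)

end

/-! ### From local orthogonal elements back to uniform property Γ. -/

section

variable {A : Type u} [NonUnitalCStarAlgebra A] [PartialOrder A] [StarOrderedRing A]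

theorem twoNorm_sq_eq_re (τ : traces A) (a : A) :
    twoNorm τ.1 a ^ 2 = (τ.1 (star a * a)).re := by
  rw [← twoNorm_sq, Complex.ofReal_re]

theorem twoNorm_sq_le_re (τ : traces A) {e : A} (he : 0 ≤ e) (he1 : ‖e‖ ≤ 1) :
    twoNorm τ.1 e ^ 2 ≤ (τ.1 e).re := by
  obtain ⟨s, rfl⟩ := CStarAlgebra.nonneg_iff_eq_star_mul_self.1 he
  rw [← twoNorm_sq_eq_re]
  refine pow_le_pow_left₀ (twoNorm_nonneg _ _) ((twoNorm_mul_le τ _ _).trans ?_) 2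
  refine mul_le_of_le_one_left (twoNorm_nonneg _ _) ?_
  rw [CStarRing.norm_star_mul_self] at he1
  rw [norm_star]
  nlinarith [norm_nonneg s]

theorem re_trace_mono (τ : traces A) {a b : A} (hab : a ≤ b) : (τ.1 a).re ≤ (τ.1 b).re := by
  have h := (Complex.le_def.1 (τ.2.1 (b - a) (sub_nonneg.2 hab))).1
  rw [map_sub, Complex.sub_re, Complex.zero_re] at h
  linarith

/-- Take a in the unit ball with |τ(a)| near 1 and u from an approximate unit: |τ(ua)| ≤ ‖u‖_{2,τ}
and ‖u‖_{2,τ}² ≤ τ(u), so τ(u) is near 1. Scaling by t < 1 puts u in the open ball, whose positive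
part is directed. -/
theorem exists_nonneg_ball_lt_re_trace (τ : traces A) {ε : ℝ} (hε : 0 < ε) :
    ∃ u : A, 0 ≤ u ∧ ‖u‖ < 1 ∧ 1 - ε < (τ.1 u).re := by
  obtain ⟨a, ha1, ha⟩ := (WeakDual.toStrongDual τ.1).exists_lt_apply_of_lt_opNorm
    (show 1 - ε / 4 < _ by rw [τ.2.2.1]; linarith)
  have hl := CStarAlgebra.increasingApproximateUnit A
  have := hl.toIsApproximateUnit.neBot
  have h1 : Tendsto (fun u : A => ‖τ.1 (u * a)‖) (CStarAlgebra.approximateUnit A)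
      (𝓝 ‖τ.1 a‖) :=
    ((τ.1.continuous.tendsto a).comp (hl.toIsApproximateUnit.tendsto_mul_right a)).norm
  obtain ⟨u, hu1, hu0, hu⟩ := ((h1.eventually (lt_mem_nhds ha)).and
    (hl.eventually_nonneg.and hl.eventually_norm)).exists
  have h3 := twoNorm_sq_le_re τ hu0 hu
  have h4 : ‖τ.1 (u * a)‖ ≤ twoNorm τ.1 u :=
    (norm_trace_le_twoNorm τ _).trans ((twoNorm_mul_le' τ u a).trans
      (mul_le_of_le_one_right (twoNorm_nonneg _ _) ha1.le))
  have h5 : 1 - ε / 2 < (τ.1 u).re := by nlinarith [sq_nonneg (twoNorm τ.1 u - 1)]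
  have h6 : (τ.1 u).re ≤ 1 := (Complex.re_le_norm _).trans ((norm_trace_le τ u).trans hu)
  set t : ℝ := 1 - min (ε / 2) 1 with ht
  have ht0 : 0 ≤ t := sub_nonneg.2 (min_le_right _ _)
  have ht1 : t < 1 := sub_lt_self _ (lt_min (half_pos hε) one_pos)
  have ht2 : 1 - t ≤ ε / 2 := by rw [ht, sub_sub_cancel]; exact min_le_left _ _
  refine ⟨(t : ℂ) • u, smul_nonneg (Complex.zero_le_real.2 ht0) hu0, ?_, ?_⟩
  · rw [norm_smul, Complex.norm_real, Real.norm_of_nonneg ht0]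
    exact (mul_le_of_le_one_right ht0 hu).trans_lt ht1
  · rw [map_smul, smul_eq_mul, Complex.re_ofReal_mul]
    nlinarith

/-- If `T(A)` is compact, some positive contraction is almost of full trace, uniformly over all
traces. -/
theorem exists_forall_lt_re_trace (hcpt : IsCompact (traces A)) {ε : ℝ} (hε : 0 < ε) :
    ∃ u : A, 0 ≤ u ∧ ‖u‖ ≤ 1 ∧ ∀ τ : traces A, 1 - ε < (τ.1 u).re := by
  let ι := {u : A // 0 ≤ u ∧ ‖u‖ < 1}
  have : Nonempty ι := ⟨⟨0, le_rfl, by simp⟩⟩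
  -- Taking the union over all v ≤ u makes the open cover increasing in u, hence directed;
  -- monotonicity of traces brings the bound back to u.
  let U : ι → Set (WeakDual ℂ A) := fun u => ⋃ v : {v : ι // v.1 ≤ u.1}, {τ | 1 - ε < (τ v.1.1).re}
  obtain ⟨u, hu⟩ := hcpt.elim_directed_cover U
    (fun u => isOpen_iUnion fun v => isOpen_lt continuous_const
      (Complex.continuous_re.comp (WeakDual.eval_continuous _)))
    (fun τ hτ => by
      obtain ⟨u, hu0, hu1, hu⟩ := exists_nonneg_ball_lt_re_trace ⟨τ, hτ⟩ hε
      exact Set.mem_iUnion.2 ⟨⟨u, hu0, hu1⟩, Set.mem_iUnion.2 ⟨⟨⟨u, hu0, hu1⟩, le_rfl⟩, hu⟩⟩)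
    (fun u v => by
      obtain ⟨w, hw, huw, hvw⟩ := CStarAlgebra.directedOn_nonneg_ball u.1 (by simpa using u.2)
        v.1 (by simpa using v.2)
      refine ⟨⟨w, by simpa using hw⟩, ?_, ?_⟩
      · exact Set.iUnion_subset fun x => Set.subset_iUnion_of_subset ⟨x.1, x.2.trans huw⟩ le_rfl
      · exact Set.iUnion_subset fun x => Set.subset_iUnion_of_subset ⟨x.1, x.2.trans hvw⟩ le_rfl)
  refine ⟨u.1, u.2.1, u.2.2.le, fun τ => ?_⟩
  obtain ⟨v, hv⟩ := Set.mem_iUnion.1 (hu τ.2)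
  exact hv.trans_le (re_trace_mono τ v.2)

/-- Formally ‖(1-f)x‖_{2,τ} ≤ ‖1-f‖_{2,τ}‖x‖, and ‖1-f‖_{2,τ}² = 1 - 2τ(f) + ‖f‖_{2,τ}². An
approximate unit stands in for 1. -/
theorem twoNorm_sub_mul_le (τ : traces A) {f : A} (hf : IsSelfAdjoint f)
    (hf1 : twoNorm τ.1 f ^ 2 ≤ (τ.1 f).re) (x : A) :
    twoNorm τ.1 (x - f * x) ≤ ‖x‖ * √(1 - twoNorm τ.1 f ^ 2) := by
  have hl := CStarAlgebra.increasingApproximateUnit A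
  have := hl.toIsApproximateUnit.neBot
  have hcont : Continuous fun a : A => twoNorm τ.1 a := by
    have := τ.1.continuous
    unfold twoNorm
    exact (Complex.continuous_re.comp (this.comp (by fun_prop))).sqrt
  have h1 : Tendsto (fun u : A => twoNorm τ.1 (u * x - f * x)) (CStarAlgebra.approximateUnit A)
      (𝓝 (twoNorm τ.1 (x - f * x))) :=
    (hcont.tendsto _).comp ((hl.toIsApproximateUnit.tendsto_mul_right x).sub_const (f * x))
  have h2 : Tendsto (fun u : A => ‖x‖ * √(1 - 2 * (τ.1 (u * f)).re + twoNorm τ.1 f ^ 2))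
      (CStarAlgebra.approximateUnit A)
      (𝓝 (‖x‖ * √(1 - 2 * (τ.1 f).re + twoNorm τ.1 f ^ 2))) := by
    have h3 : Tendsto (fun u : A => (τ.1 (u * f)).re) (CStarAlgebra.approximateUnit A)
        (𝓝 (τ.1 f).re) :=
      (Complex.continuous_re.tendsto _).comp
        ((τ.1.continuous.tendsto f).comp (hl.toIsApproximateUnit.tendsto_mul_right f))
    exact (((h3.const_mul 2).const_sub 1).add_const _).sqrt.const_mul _
  refine (le_of_tendsto_of_tendsto h1 h2 ?_).trans
    (mul_le_mul_of_nonneg_left (Real.sqrt_le_sqrt (by linarith)) (norm_nonneg x))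
  filter_upwards [hl.eventually_norm, hl.eventually_star_eq] with u hu hus
  rw [← sub_mul, mul_comm ‖x‖]
  refine (twoNorm_mul_le' τ _ _).trans (mul_le_mul_of_nonneg_right ?_ (norm_nonneg x))
  refine Real.le_sqrt_of_sq_le ?_
  have h4 : star (u - f) * (u - f) = star u * u - u * f - f * u + star f * f := by
    rw [star_sub, hus, hf.star_eq]
    noncomm_ring
  have h5 : twoNorm τ.1 u ^ 2 ≤ 1 :=
    pow_le_one₀ (twoNorm_nonneg _ _) ((twoNorm_le_norm τ u).trans hu)
  rw [twoNorm_sq_eq_re, h4, map_add, map_sub, map_sub, τ.2.2.2 f u, Complex.add_re, Complex.sub_re,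
    Complex.sub_re, ← twoNorm_sq_eq_re, ← twoNorm_sq_eq_re]
  linarith

/-- Supplies the hypothesis of `twoNorm_sub_mul_le` for the sum of the `e i`: orthogonality kills
the cross terms. -/
theorem twoNorm_sum_sq_le_re (τ : traces A) {n : ℕ} {e : Fin n → A}
    (he : ∀ i, 0 ≤ e i ∧ ‖e i‖ ≤ 1) (hee : ∀ i j, i ≠ j → e i * e j = 0) :
    twoNorm τ.1 (∑ i, e i) ^ 2 ≤ (τ.1 (∑ i, e i)).re := by
  have h1 : star (∑ i, e i) * ∑ i, e i = ∑ i, star (e i) * e i := by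
    rw [star_sum, Finset.sum_mul_sum]
    refine Finset.sum_congr rfl fun i _ => Finset.sum_eq_single i (fun j _ hj => ?_) (by simp)
    rw [(IsSelfAdjoint.of_nonneg (he i).1).star_eq, hee i j hj.symm]
  rw [twoNorm_sq_eq_re, h1, map_sum, map_sum, Complex.re_sum, Complex.re_sum]
  refine Finset.sum_le_sum fun i _ => ?_
  rw [← twoNorm_sq_eq_re]
  exact twoNorm_sq_le_re τ (he i).1 (he i).2

/-- Orthogonal positive contractions that almost divide the traces evenly at an element of almost
full trace have a sum that is almost a unit in the uniform 2-norm. -/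
theorem uniformTwoNorm_sub_sum_mul_le {n : ℕ} (hn : 1 ≤ n) {e : Fin n → A}
    (he : ∀ i, 0 ≤ e i ∧ ‖e i‖ ≤ 1) (hee : ∀ i j, i ≠ j → e i * e j = 0) {u : A} {ε : ℝ}
    (hu1 : ‖u‖ ≤ 1) (hu : ∀ τ : traces A, 1 - ε < (τ.1 u).re)
    (htr : ∀ i, ∀ τ : traces A, ‖τ.1 (u * e i) - (1 / (n : ℂ)) * τ.1 u‖ ≤ ε) (x : A) :
    uniformTwoNorm (traces A) (x - (∑ i, e i) * x) ≤ ‖x‖ * √(2 * (n + 1) * ε) := by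
  refine uniformTwoNorm_le (by positivity) fun τ => ?_
  refine (twoNorm_sub_mul_le τ (isSelfAdjoint_sum _ fun i _ => IsSelfAdjoint.of_nonneg (he i).1)
    (twoNorm_sum_sq_le_re τ he hee) x).trans
    (mul_le_mul_of_nonneg_left (Real.sqrt_le_sqrt ?_) (norm_nonneg x))
  have h1 : ‖τ.1 (u * ∑ i, e i)‖ ≤ twoNorm τ.1 (∑ i, e i) :=
    (norm_trace_le_twoNorm τ _).trans ((twoNorm_mul_le τ _ _).trans
      (mul_le_of_le_one_left (twoNorm_nonneg _ _) hu1))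
  have h2 : ‖τ.1 (u * ∑ i, e i) - τ.1 u‖ ≤ n * ε := by
    have h3 : τ.1 (u * ∑ i, e i) - τ.1 u =
        ∑ i, (τ.1 (u * e i) - (1 / (n : ℂ)) * τ.1 u) := by
      have hn0 : (n : ℂ) ≠ 0 := by exact_mod_cast (by omega : n ≠ 0)
      rw [Finset.sum_sub_distrib, Finset.mul_sum, map_sum, Finset.sum_const, Finset.card_univ,
        Fintype.card_fin, nsmul_eq_mul]
      field_simp
    rw [h3]
    exact (norm_sum_le_of_le _ fun i _ => htr i τ).trans (by simp)
  have h4 := (Complex.re_le_norm (τ.1 u)).trans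
    (norm_le_norm_add_norm_sub (τ.1 (u * ∑ i, e i)) (τ.1 u))
  have h5 := hu τ
  -- With t the 2-norm of the sum, 1 - t² ≤ 2(1 - t), while t ≥ Re τ(u) - nε > 1 - (n+1)ε.
  nlinarith [sq_nonneg (twoNorm τ.1 (∑ i, e i) - 1)]

-- Applied to commutators with, and trace defects of, the contractions `e k i`; both change by at
-- most 2‖a - b‖ when a is replaced by b.
omit [PartialOrder A] [StarOrderedRing A] in
theorem tendsto_zero_of_dense {d : ℕ → A} (hd : DenseRange d) {G : A → ℕ → ℝ}
    (h0 : ∀ a k, 0 ≤ G a k) (hG : ∀ a b k, G a k ≤ G b k + 2 * ‖a - b‖) {δ : ℕ → ℝ}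
    (hδ : Tendsto δ atTop (𝓝 0)) (hGd : ∀ m k, m ≤ k → G (d m) k ≤ δ k) (a : A) :
    Tendsto (G a) atTop (𝓝 0) := by
  rw [Metric.tendsto_nhds]
  intro ε hε
  obtain ⟨m, hm⟩ := hd.exists_dist_lt a (show 0 < ε / 4 by positivity)
  rw [dist_eq_norm] at hm
  filter_upwards [hδ.eventually (gt_mem_nhds (half_pos hε)), eventually_ge_atTop m] with k hk hmk
  rw [Real.dist_0_eq_abs, abs_of_nonneg (h0 a k)]
  linarith [hG a (d m) k, hGd m k hmk]

/-- Uniform property Γ follows from its local form with commutators small in the uniform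
2-norm. -/
theorem uniformPropertyGamma_of_exists_orthogonal [TopologicalSpace.SeparableSpace A]
    (hcpt : IsCompact (traces A)) {ω : Ultrafilter ℕ} (hω : (ω : Filter ℕ) ≤ cofinite)
    (H : ∀ (F : Finset A) (ε : ℝ), 0 < ε → ∀ n : ℕ, 1 ≤ n →
      ∃ e : Fin n → A, (∀ i, 0 ≤ e i ∧ ‖e i‖ ≤ 1) ∧ (∀ i j, i ≠ j → e i * e j = 0) ∧
        ∀ i, ∀ a ∈ F, uniformTwoNorm (traces A) (e i * a - a * e i) < ε ∧
          (⨆ τ : traces A, ‖τ.1 (a * e i) - (1 / (n : ℂ)) * τ.1 a‖) < ε) :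
    UniformPropertyGamma A ω := by
  classical
  intro n hn
  rw [Nat.cofinite_eq_atTop] at hω
  let δ : ℕ → ℝ := fun k => 1 / ((k : ℝ) + 1)
  have hδ0 : ∀ k, 0 < δ k := fun k => Nat.one_div_pos_of_nat
  have hδ : Tendsto δ atTop (𝓝 0) := tendsto_one_div_add_atTop_nhds_zero_nat
  let d : ℕ → A := TopologicalSpace.denseSeq A
  have hd : DenseRange d := TopologicalSpace.denseRange_denseSeq A
  choose u _ hu1 hu using fun k => exists_forall_lt_re_trace hcpt (hδ0 k)
  -- The k-th stage handles the first k+1 terms of the dense sequence and also `u k`, which is what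
  -- forces the classes to sum to the unit.
  choose e he hee hcom using fun k =>
    H (insert (u k) ((Finset.range (k + 1)).image d)) (δ k) (hδ0 k) n hn
  have hmem : ∀ m k, m ≤ k → d m ∈ insert (u k) ((Finset.range (k + 1)).image d) :=
    fun m k hmk => Finset.mem_insert_of_mem
      (Finset.mem_image_of_mem d (Finset.mem_range.2 (Nat.lt_succ_of_le hmk)))
  have hC : ∀ i a, Tendsto (fun k => uniformTwoNorm (traces A) (e k i * a - a * e k i)) atTop
      (𝓝 0) := by
    intro i
    refine tendsto_zero_of_dense hd (fun _ _ => uniformTwoNorm_nonneg _) (fun a b k => ?_) hδ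
      fun m k hmk => (hcom k i _ (hmem m k hmk)).1.le
    have h1 : e k i * a - a * e k i =
        (e k i * b - b * e k i) + (e k i * (a - b) - (a - b) * e k i) := by noncomm_ring
    rw [h1]
    refine (uniformTwoNorm_add_le _ _).trans (add_le_add_right
      ((uniformTwoNorm_le_norm _).trans ((norm_sub_le _ _).trans ?_)) _)
    have h2 := (norm_mul_le (e k i) (a - b)).trans
      (mul_le_of_le_one_left (norm_nonneg _) (he k i).2)
    have h3 := (norm_mul_le (a - b) (e k i)).trans
      (mul_le_of_le_one_right (norm_nonneg _) (he k i).2)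
    linarith
  have hT : ∀ i a, Tendsto (fun k => ⨆ τ : traces A,
      ‖τ.1 (a * e k i) - (1 / (n : ℂ)) * τ.1 a‖) atTop (𝓝 0) := by
    intro i
    refine tendsto_zero_of_dense hd (fun _ _ => Real.iSup_nonneg fun _ => norm_nonneg _)
      (fun a b k => ?_) hδ fun m k hmk => (hcom k i _ (hmem m k hmk)).2.le
    refine Real.iSup_le (fun τ => ?_)
      (add_nonneg (Real.iSup_nonneg fun _ => norm_nonneg _) (by positivity))
    have h1 : τ.1 (a * e k i) - (1 / (n : ℂ)) * τ.1 a =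
        (τ.1 (b * e k i) - (1 / (n : ℂ)) * τ.1 b) +
          (τ.1 ((a - b) * e k i) - (1 / (n : ℂ)) * τ.1 (a - b)) := by
      rw [sub_mul, map_sub, map_sub]
      ring
    rw [h1]
    refine (norm_add_le _ _).trans (add_le_add (le_ciSup (bddAbove_norm_trace_sub _ b _) τ)
      ((norm_sub_le _ _).trans ?_))
    have h2 : ‖τ.1 ((a - b) * e k i)‖ ≤ ‖a - b‖ := (norm_trace_le τ _).trans
      ((norm_mul_le _ _).trans (mul_le_of_le_one_right (norm_nonneg _) (he k i).2))
    have h3 : ‖(1 / (n : ℂ)) * τ.1 (a - b)‖ ≤ ‖a - b‖ := by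
      rw [norm_mul]
      refine (mul_le_of_le_one_left (norm_nonneg _) ?_).trans (norm_trace_le τ _)
      rw [norm_div, norm_one, Complex.norm_natCast]
      exact div_le_one_of_le₀ (by exact_mod_cast hn) (Nat.cast_nonneg n)
    linarith
  let E : Fin n → BoundedSeq A := fun i =>
    ⟨fun k => e k i, memℓp_infty ⟨1, by rintro _ ⟨k, rfl⟩; exact (he k i).2⟩⟩
  let p : Fin n → TracialUltrapower A ω := fun i => mk ω (E i)
  have hsa : ∀ i, star (p i) = p i := fun i => by
    have h1 : star (E i) = E i :=
      lp.ext (funext fun k => (IsSelfAdjoint.of_nonneg (he k i).1).star_eq)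
    rw [star_mk, h1]
  have hpp : ∀ i j, i ≠ j → p i * p j = 0 := fun i j hij => by
    have h1 : E i * E j = 0 := lp.ext (funext fun k => hee k i j hij)
    rw [← mk_mul, h1, mk_zero]
  have hsum : ∀ x, (∑ i, p i) * x = x := by
    intro x
    obtain ⟨x, rfl⟩ := mk_surjective ω x
    rw [← mk_sum, ← mk_mul, eq_comm, ← sub_eq_zero, ← mk_sub, mk_eq_zero_iff]
    have h1 : Tendsto (fun k => ‖x‖ * √(2 * (n + 1) * δ k)) ω (𝓝 0) := by
      have := ((hδ.mono_left hω).const_mul (2 * ((n : ℝ) + 1))).sqrt.const_mul ‖x‖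
      simpa using this
    refine squeeze_zero (fun k => uniformTwoNorm_nonneg _) (fun k => ?_) h1
    have h2 : (x - (∑ i, E i) * x) k = x k - (∑ i, e k i) * x k := by
      rw [lp.coeFn_sub, Pi.sub_apply, lp.infty_coeFn_mul, Pi.mul_apply, coeFn_sum_apply]
    rw [h2]
    refine (uniformTwoNorm_sub_sum_mul_le hn (he k) (hee k) (hu1 k) (hu k) (fun i τ => ?_)
      (x k)).trans (mul_le_mul_of_nonneg_right (lp.norm_apply_le_norm ENNReal.top_ne_zero x k)
        (Real.sqrt_nonneg _))
    exact (le_ciSup (bddAbove_norm_trace_sub _ _ _) τ).trans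
      (hcom k i _ (Finset.mem_insert_self _ _)).2.le
  refine ⟨p, fun i => ⟨⟨?_, hsa i⟩, fun a => ?_⟩, fun x => ⟨hsum x, ?_⟩, fun a φ hφ i => ?_⟩
  -- By orthogonality the unit times `p i` is `p i * p i`, so `p i` is idempotent.
  · have h1 := hsum (p i)
    rwa [Finset.sum_mul, Finset.sum_eq_single i (fun j _ hj => hpp j i hj) (by simp)] at h1
  · rw [commute_iff_eq, iota, ← mk_mul, ← mk_mul, mk_eq_mk_iff]
    exact (hC i a).mono_left hω
  · have h1 := congrArg star (hsum (star x))
    rw [star_mul, star_star, star_sum] at h1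
    simpa only [hsa] using h1
  · obtain ⟨τ, hτ⟩ := hφ
    have h1 := (hτ (constSeq a * E i)).sub ((hτ (constSeq a)).const_mul (1 / (n : ℂ)))
    have h2 : Tendsto (fun k => (τ k).1 (a * e k i) - (1 / (n : ℂ)) * (τ k).1 a) ω (𝓝 0) :=
      squeeze_zero_norm (fun k => le_ciSup (bddAbove_norm_trace_sub _ a _) (τ k))
        ((hT i a).mono_left hω)
    exact sub_eq_zero.1 (tendsto_nhds_unique h1 h2)

end

end

end UniformGamma

theorem proposition2p2 {A : Type*} [NonUnitalCStarAlgebra A] [PartialOrder A] [StarOrderedRing A]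
    [TopologicalSpace.SeparableSpace A]
    (hne : (UniformGamma.traces A).Nonempty) (hcpt : IsCompact (UniformGamma.traces A))
    (ω : Ultrafilter ℕ) (hω : (ω : Filter ℕ) ≤ Filter.cofinite) :
    List.TFAE
      [UniformGamma.UniformPropertyGamma A ω,
        ∀ (F : Finset A) (ε : ℝ), 0 < ε → ∀ n : ℕ, 1 ≤ n →
          ∃ e : Fin n → A, (∀ i, 0 ≤ e i ∧ ‖e i‖ ≤ 1) ∧ (∀ i j, i ≠ j → e i * e j = 0) ∧
            ∀ i, ∀ a ∈ F,
              UniformGamma.uniformTwoNorm (UniformGamma.traces A) (e i * a - a * e i) < ε ∧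
              (⨆ τ : UniformGamma.traces A, ‖τ.1 (a * e i) - (1 / (n : ℂ)) * τ.1 a‖) < ε,
        ∀ (F : Finset A) (ε : ℝ), 0 < ε → ∀ n : ℕ, 1 ≤ n →
          ∃ e : Fin n → A, (∀ i, 0 ≤ e i ∧ ‖e i‖ ≤ 1) ∧ (∀ i j, i ≠ j → e i * e j = 0) ∧
            ∀ i, ∀ a ∈ F,
              ‖e i * a - a * e i‖ < ε ∧
              (⨆ τ : UniformGamma.traces A, ‖τ.1 (a * e i) - (1 / (n : ℂ)) * τ.1 a‖) < ε] := by
  tfae_have 1 → 3 := fun h F ε hε n hn => h.exists_orthogonal hne F hε hn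
  tfae_have 3 → 2 := fun h F ε hε n hn => by
    obtain ⟨e, he, hee, h1⟩ := h F ε hε n hn
    exact ⟨e, he, hee, fun i a ha =>
      ⟨(UniformGamma.uniformTwoNorm_le_norm _).trans_lt (h1 i a ha).1, (h1 i a ha).2⟩⟩
  tfae_have 2 → 1 := UniformGamma.uniformPropertyGamma_of_exists_orthogonal hcpt hω
  tfae_finish
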